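/- Let $n>1$ and let $P(\rho,S)$ be a smooth function of $\rho>0$ and $S\in\mathbb R$. Consider compressible fluid flow in $\mathbb R^n$ with velocity $\mathbf u$, density $\rho>0$ and entropy per unit mass $S$, governed by $$\partial_t\mathbf u+\mathbf u\cdot\nabla\mathbf u+\tfrac1\rho\nabla p=0,\qquad \partial_t\rho+\nabla\cdot(\rho\mathbf u)=0,\qquad \partial_tS+\mathbf u\cdot\nabla S=0,\qquad p=P(\rho,S).$$ The flow is called non-isentropic if $\partial P/\partial S\not\equiv0$ and $S$ is an arbitrary dynamical variable; it is called isentropic if $p=P(\rho)$ does not depend on $S$, or if $S$ is constant throughout the fluid. A local function is a smooth function of $t,\mathbf x,\mathbf u,\rho>0,S$ and finitely many $\mathbf x$-derivatives of $\mathbf u,\rho,S$; $D_{\mathbf x}$ denotes the total spatial derivative, and $\mathcal D_t$ the total time derivative in which the time derivatives of $\mathbf u,\rho,S$ are replaced by means of the flow equations. A moving-boundary constant of motion is an integral $\oint_{\partial V(t)}\boldsymbol\Theta\cdot\hat{\mathbf n}\,d^{n-1}\sigma$ over the boundary of arbitrary domains $V(t)$ transported by the fluid, where $\boldsymbol\Theta$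 is a local vector function that is not identically divergence-free, and which is constant in time formally for all solutions; that is, $T=\operatorname{div}\boldsymbol\Theta=D_{\mathbf x}\cdot\boldsymbol\Theta\not\equiv0$ satisfies the local continuity equation $$\mathcal D_tT+D_{\mathbf x}\cdot(\mathbf u\,T)=0 .$$ Put $\omega^{ij}=\tfrac12(\partial_ju^i-\partial_iu^j)$ and let $\epsilon$ be the orientation (Levi-Civita) tensor. Define $$\varpi=\epsilon^{i_1j_1\cdots i_mj_m}\omega_{i_1j_1}\cdots\omega_{i_mj_m}\ (n=2m),\qquad \varpi^i=\epsilon^{ij_1k_1\cdots j_mk_m}\omega_{j_1k_1}\cdots\omega_{j_mk_m}\ (n=2m+1).$$ The density $T$ is of vorticity form if $T=F(\rho,S,\mathbf u,\varpi)$ for $n=2m$, or $T=F(\rho,S,\mathbf u,\boldsymbol\varpi)$ with $\boldsymbol\varpi=(\varpi^i)$ for $n=2m+1$, with $F$ a smooth function. (i) For non-isentropic flow there is no moving-boundary constant of motion whose density $T=\operatorname{div}\boldsymbol\Theta$ is of vorticity form. (ii) For isentropic flow in even dimensions $n=2m$, the generalized circulation $$\oint_{\partial V(t)}(\mathbf u\wedge\boldsymbol\omega^{m-1})\cdot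 d\mathbf A=\oint_{\partial V(t)}\boldsymbol\Theta_0\cdot\hat{\mathbf n}\,d^{n-1}\sigma,\qquad \Theta_0^i=\epsilon^{iji_1j_1\cdots i_{m-1}j_{m-1}}\,u_j\,\omega_{i_1j_1}\cdots\omega_{i_{m-1}j_{m-1}},$$ is a moving-boundary constant of motion whose density is of vorticity form, and it is the only one up to a constant factor: for any other such $\boldsymbol\Theta$ there is a constant $c\neq0$ such that $\boldsymbol\Theta-c\,\boldsymbol\Theta_0$ is identically divergence-free. For isentropic flow in odd dimensions $n>1$ there is none. -/

import Mathlib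

open scoped ContDiff Topology

noncomputable section

namespace Fluid

/-- Points of `ℝⁿ` in Cartesian coordinates (also used for vectors). -/
abbrev Space (n : ℕ) : Type := Fin n → ℝ

/-- Values `(u, ρ, S)` of the fluid variables: velocity, density, entropy per unit mass. -/
abbrev Phase (n : ℕ) : Type := Space n × ℝ × ℝ

/-- The fluid fields `x ↦ (u(x), ρ(x), S(x))` at one instant of time. -/
abbrev Fields (n : ℕ) : Type := Space n → Phase n

variable {n : ℕ}

def velocity (U : Fields n) (x : Space n) : Space n := (U x).1

def density (U : Fields n) (x : Space n) : ℝ := (U x).2.1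

def entropy (U : Fields n) (x : Space n) : ℝ := (U x).2.2

/-- The partial derivative `∂f/∂xⁱ`. -/
def partialDeriv (i : Fin n) (f : Space n → ℝ) (x : Space n) : ℝ :=
  fderiv ℝ f x (Pi.single i 1)

/-- The divergence `∑ᵢ ∂Yⁱ/∂xⁱ`. -/
def divergence (Y : Space n → Space n) (x : Space n) : ℝ :=
  ∑ i, partialDeriv i (fun y => Y y i) x

/-! ### The flow equations -/

/-- `P(ρ, S)` is smooth on `ρ > 0`. -/
def IsEquationOfState (P : ℝ → ℝ → ℝ) : Prop :=
  ContDiffOn ℝ ∞ (fun q : ℝ × ℝ => P q.1 q.2) {q | 0 < q.1}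

/-- `∂P/∂S` does not vanish identically. -/
def IsNonisentropic (P : ℝ → ℝ → ℝ) : Prop :=
  ∃ ρ S : ℝ, 0 < ρ ∧ deriv (P ρ) S ≠ 0

/-- The time derivatives `(∂ₜu, ∂ₜρ, ∂ₜS)` prescribed by
`∂ₜu + u·∇u + ρ⁻¹∇p = 0`, `∂ₜρ + ∇·(ρu) = 0`, `∂ₜS + u·∇S = 0` with `p = P(ρ, S)`. -/
def eulerRHS (P : ℝ → ℝ → ℝ) (U : Fields n) : Fields n := fun x =>
  (fun i =>
      -(∑ j, velocity U x j * partialDeriv j (fun y => velocity U y i) x)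
        - (density U x)⁻¹ * partialDeriv i (fun y => P (density U y) (entropy U y)) x,
    -divergence (fun y => density U y • velocity U y) x,
    -∑ j, velocity U x j * partialDeriv j (entropy U) x)

/-- The fields `U` are smooth near `x`, with positive density at `x` (hence near `x`). -/
def IsRegularAt (U : Fields n) (x : Space n) : Prop :=
  (∀ᶠ y in 𝓝 x, ContDiffAt ℝ ∞ U y) ∧ 0 < density U x

/-- As `IsRegularAt`, with the entropy equal to the constant `s₀` near `x`. -/
def IsConstEntropyAt (s₀ : ℝ) (U : Fields n) (x : Space n) : Prop :=
  IsRegularAt U x ∧ ∀ᶠ y in 𝓝 x, entropy U y = s₀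

/-- Isentropic flow: either `p = P(ρ)` does not depend on the entropy, or the entropy is
constant throughout the fluid. The predicate `𝒜` tells which local fields are considered. -/
def IsIsentropicFlow (P : ℝ → ℝ → ℝ) (𝒜 : Fields n → Space n → Prop) : Prop :=
  (𝒜 = IsRegularAt ∧ ∃ p : ℝ → ℝ, ∀ ρ S : ℝ, 0 < ρ → P ρ S = p ρ) ∨
    ∃ s₀ : ℝ, 𝒜 = IsConstEntropyAt s₀

/-! ### Local functions and total derivatives -/

/-- The values of the spatial derivatives of `(u, ρ, S)` of orders `1, …, k` at a point. -/
abbrev Derivs (n k : ℕ) : Type := ∀ j : Fin k, Space n [×(j.1 + 1)]→L[ℝ] Phase n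

/-- `Θ(t, x)[U]` is a smooth function of `t, x, u, ρ, S` (with `ρ > 0`) and finitely many
`x`-derivatives of `u, ρ, S`, evaluated at the fields `U` and the point `x`. -/
def IsLocalVector (𝒜 : Fields n → Space n → Prop)
    (Θ : ℝ → Fields n → Space n → Space n) : Prop :=
  ∃ (k : ℕ) (L : ℝ × Space n × Phase n × Derivs n k → Space n),
    ContDiffOn ℝ ∞ L {q | 0 < q.2.2.1.2.1} ∧
      ∀ t U x, 𝒜 U x →
        Θ t U x = L (t, x, U x, fun j => iteratedFDeriv ℝ (j.1 + 1) U x)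

/-- The total spatial divergence `div Θ = D_x · Θ`. -/
def totalDiv (Θ : ℝ → Fields n → Space n → Space n) : ℝ → Fields n → Space n → ℝ :=
  fun t U x => divergence (Θ t U) x

/-- The total time derivative `𝒟ₜT` evaluated on solutions: the derivative of `T` along the
velocity `∂ₜU = eulerRHS P U` of the fields. (`T` involves no time derivatives of the fields.) -/
def evolDeriv (P : ℝ → ℝ → ℝ) (T : ℝ → Fields n → Space n → ℝ) :
    ℝ → Fields n → Space n → ℝ :=
  fun t U x => deriv (fun s : ℝ => T (t + s) (U + s • eulerRHS P U) x) 0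

/-- The continuity equation `𝒟ₜT + D_x · (u T) = 0` for a density `T` whose integral over every
domain moving with the fluid is constant in time, holding formally for all solutions. -/
def HasZeroMovingFlux (P : ℝ → ℝ → ℝ) (𝒜 : Fields n → Space n → Prop)
    (T : ℝ → Fields n → Space n → ℝ) : Prop :=
  ∀ t U x, 𝒜 U x →
    evolDeriv P T t U x + divergence (fun y => T t U y • velocity U y) x = 0

/-- `Θ` is a local vector function which is not identically divergence-free and whose integrals
`∮ Θ · n̂` over the boundaries of domains moving with the fluid are constant in time, which is
expressed by the continuity equation of the density `T = div Θ`. -/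
def IsMovingBoundaryCOM (P : ℝ → ℝ → ℝ) (𝒜 : Fields n → Space n → Prop)
    (Θ : ℝ → Fields n → Space n → Space n) : Prop :=
  IsLocalVector 𝒜 Θ ∧
    (∃ t U x, 𝒜 U x ∧ totalDiv Θ t U x ≠ 0) ∧
    HasZeroMovingFlux P 𝒜 (totalDiv Θ)

/-! ### Vorticity -/

/-- The curl `ω^{ij} = ½ (∂ⱼuⁱ - ∂ᵢuʲ)`. -/
def curl (U : Fields n) (x : Space n) (i j : Fin n) : ℝ :=
  (partialDeriv j (fun y => velocity U y i) x - partialDeriv i (fun y => velocity U y j) x) / 2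

/-- For `n = 2m`, the vorticity scalar `ϖ = ∗(ω^m) = ε^{i₁j₁⋯iₘjₘ} ω_{i₁j₁}⋯ω_{iₘjₘ}`;
the sum over the indices is written as a sum over the permutations `σ = (i₁j₁⋯iₘjₘ)`. -/
def vorticityScalar (U : Fields n) (x : Space n) : ℝ :=
  ∑ σ : Equiv.Perm (Fin n), ((Equiv.Perm.sign σ : ℤ) : ℝ) *
    ∏ k : Fin (n / 2),
      curl U x (σ ⟨2 * k.1, by have := k.2; omega⟩) (σ ⟨2 * k.1 + 1, by have := k.2; omega⟩)

/-- For `n = 2m + 1`, the vorticity vector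
`ϖ^i = ∗(ω^m)^i = ε^{i j₁k₁⋯jₘkₘ} ω_{j₁k₁}⋯ω_{jₘkₘ}`. -/
def vorticityVector (U : Fields n) (x : Space n) : Space n := fun i =>
  ∑ σ : Equiv.Perm (Fin n) with (σ.symm i).1 = 0, ((Equiv.Perm.sign σ : ℤ) : ℝ) *
    ∏ k : Fin ((n - 1) / 2),
      curl U x (σ ⟨2 * k.1 + 1, by have := k.2; omega⟩) (σ ⟨2 * k.1 + 2, by have := k.2; omega⟩)

/-- For `n = 2m`, the tensor
`w^{ij} = ∗(ω^{m-1})^{ij} = ε^{ij i₁j₁⋯} ω_{i₁j₁}⋯` (with `m - 1` factors `ω`). -/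
def vorticityTensor (U : Fields n) (x : Space n) (i j : Fin n) : ℝ :=
  ∑ σ : Equiv.Perm (Fin n) with (σ.symm i).1 = 0 ∧ (σ.symm j).1 = 1,
    ((Equiv.Perm.sign σ : ℤ) : ℝ) *
    ∏ k : Fin ((n - 2) / 2),
      curl U x (σ ⟨2 * k.1 + 2, by have := k.2; omega⟩) (σ ⟨2 * k.1 + 3, by have := k.2; omega⟩)

/-- `T` is of vorticity form: a smooth function of `ρ > 0`, `S`, `u` and the vorticity scalar
(`n` even) or vorticity vector (`n` odd). -/
def HasVorticityForm (𝒜 : Fields n → Space n → Prop)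
    (T : ℝ → Fields n → Space n → ℝ) : Prop :=
  (Even n ∧ ∃ F : ℝ × ℝ × Space n × ℝ → ℝ, ContDiffOn ℝ ∞ F {q | 0 < q.1} ∧
      ∀ t U x, 𝒜 U x →
        T t U x = F (density U x, entropy U x, velocity U x, vorticityScalar U x)) ∨
    (Odd n ∧ ∃ F : ℝ × ℝ × Space n × Space n → ℝ, ContDiffOn ℝ ∞ F {q | 0 < q.1} ∧
      ∀ t U x, 𝒜 U x →
        T t U x = F (density U x, entropy U x, velocity U x, vorticityVector U x))

/-- For `n = 2m`, the vector function `Θ^i = w^{ij} uⱼ` of the generalized circulation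
`∮ Θ · n̂ dσ = ∮ (u ∧ ω^{m-1}) · dA` with `dA = ∗n̂ dσ`. -/
def circulation (_t : ℝ) (U : Fields n) (x : Space n) : Space n := fun i =>
  ∑ j, vorticityTensor U x i j * velocity U x j

end Fluid

end

noncomputable section

namespace Fluid

variable {n : ℕ}

/-! ### The Pfaffian -/

/-! Two conditions are played against each other: $T$ is a divergence, and $T$ satisfies the
continuity equation. The first makes the integral of $T$ insensitive to compactly supported
variations of the fields (`integral_totalDiv_sub`), so its first variation vanishes
(`integral_variation_eq_zero`). Varying the density alone gives $F_\rho=0$ at antisymmetric velocity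
gradients.

The second condition is tested on constant density and entropy with an affine velocity field. There
the pressure gradient vanishes, so the equation of state plays no role. With velocity gradient
$M+1$, $M$ antisymmetric, `flux_affineField` combined with $F_\rho=0$ says that $F$ satisfies
Euler's relation of degree $n/(2m)$ in the vorticity quantity, where $m$ is the number of factors
$\omega$ (`euler_homogeneity`).

For $n=2m+1$, substituting $r^{2m}v$ for the vorticity vector gives a smooth function of $r$
homogeneous of odd degree $n$ but even in $r$, hence zero (`eq_zero_of_odd`). For $n=2m$ the degree
is one, so $F=b(\mathbf u)\,\varpi$ at each fixed entropy. Varying the velocity around a field with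
$\varpi=0$ then forces $\nabla b=0$ (`exists_eq_const_mul_vorticityScalar`), and when the entropy is
free, varying it removes the dependence on $S$. Thus $T=c\,\varpi$.

It remains to see when $\varpi$ is conserved. It is minus the divergence of the circulation vector
(`totalDiv_circulation`). Since $\varpi$ is a multiple of the Pfaffian of $\omega$, which scales by
the determinant under congruence, the stretching of $\omega$ by the flow is balanced by the
expansion $\operatorname{div}\mathbf u$. Only the baroclinic source, built from $d\rho\wedge dp$,
survives (`flux_vorticityScalar`). It vanishes in isentropic flow, and is nonzero for a suitable
stratified field as soon as $\partial P/\partial S\ne0$ at one point. -/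

/-- The first index `2k` of the `k`-th pair. -/
def pairFst (k : Fin (n / 2)) : Fin n := ⟨2 * k.1, by have := k.2; omega⟩

/-- The second index `2k + 1` of the `k`-th pair. -/
def pairSnd (k : Fin (n / 2)) : Fin n := ⟨2 * k.1 + 1, by have := k.2; omega⟩

/-- `ε^{i₁j₁⋯iₘjₘ} M_{i₁j₁}⋯M_{iₘjₘ}`, that is, `2ᵐ m!` times the Pfaffian of `M` if `M` is
antisymmetric and `n = 2m`. -/
def pfaffian (M : Fin n → Fin n → ℝ) : ℝ :=
  ∑ σ : Equiv.Perm (Fin n), ((Equiv.Perm.sign σ : ℤ) : ℝ) *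
    ∏ k : Fin (n / 2), M (σ (pairFst k)) (σ (pairSnd k))

theorem vorticityScalar_eq (U : Fields n) (x : Space n) :
    vorticityScalar U x = pfaffian (curl U x) := rfl

theorem eq_pairFst_or_eq_pairSnd (hn : Even n) (l : Fin n) :
    ∃ k : Fin (n / 2), l = pairFst k ∨ l = pairSnd k := by
  obtain ⟨m, hm⟩ := hn
  refine ⟨⟨l.1 / 2, by have := l.2; omega⟩, ?_⟩
  simp only [pairFst, pairSnd, Fin.ext_iff]
  omega

theorem pairFst_ne_pairSnd (k j : Fin (n / 2)) : pairFst k ≠ pairSnd j := by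
  simp only [pairFst, pairSnd, Fin.ext_iff, ne_eq]
  omega

theorem pairFst_inj {k j : Fin (n / 2)} : pairFst k = pairFst j ↔ k = j := by
  simp only [pairFst, Fin.ext_iff]
  omega

theorem pairSnd_inj {k j : Fin (n / 2)} : pairSnd k = pairSnd j ↔ k = j := by
  simp only [pairSnd, Fin.ext_iff]
  omega

/-- The multilinear form `v ↦ ∏ₖ M(v_{2k}, v_{2k+1})`. -/
def pairingForm (hn : Even n) (B : LinearMap.BilinForm ℝ (Space n)) :
    MultilinearMap ℝ (fun _ : Fin n => Space n) ℝ where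
  toFun v := ∏ k : Fin (n / 2), B (v (pairFst k)) (v (pairSnd k))
  map_update_add' {inst} v l x y := by
    rw [Subsingleton.elim inst (instDecidableEqFin n)]
    obtain ⟨k, rfl | rfl⟩ := eq_pairFst_or_eq_pairSnd hn l <;>
    · rw [← Finset.mul_prod_erase _ _ (Finset.mem_univ k),
        ← Finset.mul_prod_erase _ _ (Finset.mem_univ k),
        ← Finset.mul_prod_erase _ _ (Finset.mem_univ k)]
      simp only [Function.update_self, Function.update_of_ne (pairFst_ne_pairSnd _ _),
        Function.update_of_ne (pairFst_ne_pairSnd _ _).symm, map_add, LinearMap.add_apply, add_mul]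
      congr 2 <;>
      · refine Finset.prod_congr rfl fun j hj => ?_
        have hj' : j ≠ k := Finset.ne_of_mem_erase hj
        simp [pairFst_inj, pairSnd_inj, hj']
  map_update_smul' {inst} v l c x := by
    rw [Subsingleton.elim inst (instDecidableEqFin n)]
    obtain ⟨k, rfl | rfl⟩ := eq_pairFst_or_eq_pairSnd hn l <;>
    · rw [← Finset.mul_prod_erase _ _ (Finset.mem_univ k),
        ← Finset.mul_prod_erase _ _ (Finset.mem_univ k)]
      simp only [Function.update_self, Function.update_of_ne (pairFst_ne_pairSnd _ _),
        Function.update_of_ne (pairFst_ne_pairSnd _ _).symm, map_smul, LinearMap.smul_apply,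
        smul_eq_mul, mul_assoc]
      congr 2
      refine Finset.prod_congr rfl fun j hj => ?_
      have hj' : j ≠ k := Finset.ne_of_mem_erase hj
      simp [pairFst_inj, pairSnd_inj, hj']

/-- The Pfaffian is a relative invariant of the general linear group. -/
theorem pfaffian_congruence (hn : Even n) (A M : Fin n → Fin n → ℝ) :
    pfaffian (fun i j => ∑ k, ∑ l, A k i * M k l * A l j) =
      (Matrix.of A).det * pfaffian M := by
  set B : LinearMap.BilinForm ℝ (Space n) := Matrix.toBilin' (Matrix.of M) with hB
  -- The alternatized pairing, evaluated on the columns of $C$, is the Pfaffian of $C^TMC$. An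
  -- alternating $n$-form on $\mathbb R^n$ is a multiple of the determinant, and $C=1$ identifies
  -- the multiple.
  have key : ∀ C : Fin n → Fin n → ℝ,
      MultilinearMap.alternatization (pairingForm hn B) (fun j i => C i j) =
        pfaffian (fun i j => ∑ k, ∑ l, C k i * M k l * C l j) := by
    intro C
    rw [MultilinearMap.alternatization_apply, pfaffian]
    refine Finset.sum_congr rfl fun σ _ => ?_
    rw [Units.smul_def, zsmul_eq_mul]
    congr 1
    change ∏ k : Fin (n / 2), B (fun i => C i (σ (pairFst k))) (fun i => C i (σ (pairSnd k))) = _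
    refine Finset.prod_congr rfl fun k _ => ?_
    rw [hB, Matrix.toBilin'_apply]
    rfl
  have h1 := key fun i j => if i = j then 1 else 0
  have hM : (fun i j => ∑ k, ∑ l, (if k = i then 1 else 0) * M k l *
      (if l = j then 1 else 0)) = M := by
    funext i j
    simp
  rw [hM] at h1
  rw [← key A, ← h1]
  generalize MultilinearMap.alternatization (pairingForm hn B) = g
  rw [g.eq_smul_basis_det (Pi.basisFun ℝ (Fin n))]
  simp only [AlternatingMap.smul_apply, Pi.basisFun_det_apply, smul_eq_mul]
  have e1 : (Matrix.of fun j i => A i j).det = (Matrix.of A).det := (Matrix.of A).det_transpose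
  have e2 : (Matrix.of fun j i : Fin n => if i = j then (1 : ℝ) else 0).det = 1 := by
    rw [← Matrix.det_one (n := Fin n) (R := ℝ)]
    congr 1
    ext i j
    simp [Matrix.one_apply, eq_comm]
  rw [e1, e2]
  ring

theorem contDiff_pfaffian {k : WithTop ℕ∞} : ContDiff ℝ k (pfaffian (n := n)) := by
  unfold pfaffian
  refine ContDiff.sum fun σ _ => contDiff_const.mul (contDiff_prod fun k _ => ?_)
  fun_prop

theorem hasFDerivAt_pfaffian (M : Fin n → Fin n → ℝ) :
    HasFDerivAt (pfaffian (n := n)) (fderiv ℝ pfaffian M) M :=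
  ((contDiff_pfaffian (k := 1)).differentiable (by simp) M).hasFDerivAt

theorem pfaffian_smul (c : ℝ) (M : Fin n → Fin n → ℝ) :
    pfaffian (c • M) = c ^ (n / 2) * pfaffian M := by
  simp only [pfaffian, Pi.smul_apply, smul_eq_mul, Finset.prod_mul_distrib, Finset.prod_const,
    Finset.card_univ, Fintype.card_fin, Finset.mul_sum]
  exact Finset.sum_congr rfl fun σ _ => by ring

/-- This is `pfaffian_congruence` differentiated along $1+\varepsilon A$ at $\varepsilon=0$. With
$A=\nabla\mathbf u$ the trace is $\operatorname{div}\mathbf u$, so it exchanges the expansion term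
of the continuity equation for the stretching of the vorticity. -/
theorem fderiv_pfaffian_congruence (hn : Even n) (A M : Fin n → Fin n → ℝ) :
    fderiv ℝ pfaffian M (fun i j => ∑ k, (A k i * M k j + M i k * A k j)) =
      (∑ i, A i i) * pfaffian M := by
  have hdet : HasDerivAt (fun ε : ℝ => (1 + ε • Matrix.of A).det) (∑ i, A i i) 0 := by
    have h : (fun ε : ℝ => (1 + ε • Matrix.of A).det) = fun ε : ℝ =>
        ((1 + (Polynomial.X : Polynomial ℝ) • (Matrix.of A).map Polynomial.C).det).eval ε := by
      funext ε
      have := RingHom.map_det (Polynomial.evalRingHom ε)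
        (1 + (Polynomial.X : Polynomial ℝ) • (Matrix.of A).map Polynomial.C)
      rw [Polynomial.coe_evalRingHom] at this
      rw [this]
      congr 1
      ext i j
      simp [Matrix.one_apply, apply_ite (Polynomial.eval ε), mul_comm ε]
    rw [h]
    have h2 := ((1 + (Polynomial.X : Polynomial ℝ) •
      (Matrix.of A).map Polynomial.C).det).hasDerivAt 0
    rw [Matrix.derivative_det_one_add_X_smul] at h2
    exact h2
  have hcurve : HasDerivAt (fun ε : ℝ => (fun i j => ∑ k, ∑ l,
      (1 + ε • Matrix.of A) k i * M k l * (1 + ε • Matrix.of A) l j : Fin n → Fin n → ℝ))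
      (fun i j => ∑ k, (A k i * M k j + M i k * A k j)) 0 := by
    refine hasDerivAt_pi.2 fun i => hasDerivAt_pi.2 fun j => ?_
    have hent : ∀ a b : Fin n, HasDerivAt (fun ε : ℝ => (1 + ε • Matrix.of A) a b) (A a b) 0 := by
      intro a b
      simp only [Matrix.add_apply, Matrix.smul_apply, Matrix.of_apply, smul_eq_mul]
      simpa using ((hasDerivAt_id (0 : ℝ)).mul_const (A a b)).const_add
        ((1 : Matrix (Fin n) (Fin n) ℝ) a b)
    have := HasDerivAt.fun_sum (u := Finset.univ) fun k _ => HasDerivAt.fun_sum (u := Finset.univ)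
      fun l _ => (((hent k i).mul_const (M k l)).mul (hent l j))
    refine this.congr_deriv (Eq.symm ?_)
    simp only [zero_smul, add_zero, Finset.sum_add_distrib]
    congr 1
    · simp [Matrix.one_apply]
    · rw [Finset.sum_comm]
      simp [Matrix.one_apply]
  have h0 : (fun i j => ∑ k, ∑ l, (1 + (0 : ℝ) • Matrix.of A) k i * M k l *
      (1 + (0 : ℝ) • Matrix.of A) l j : Fin n → Fin n → ℝ) = M := by
    funext i j
    simp [Matrix.one_apply]
  have hf := hasFDerivAt_pfaffian M
  have h1 := HasFDerivAt.comp_hasDerivAt_of_eq (0 : ℝ) hf hcurve h0.symm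
  have h2 : (pfaffian ∘ fun ε : ℝ => (fun i j => ∑ k, ∑ l,
      (1 + ε • Matrix.of A) k i * M k l * (1 + ε • Matrix.of A) l j : Fin n → Fin n → ℝ)) =
      fun ε => (1 + ε • Matrix.of A).det * pfaffian M := by
    funext ε
    exact pfaffian_congruence hn _ M
  rw [h2] at h1
  exact h1.unique (hdet.mul_const _)

/-! ### A nondegenerate antisymmetric form -/

/-- The standard symplectic form on `ℝ^ι ⊗ ℝ²`. -/
def stdForm {ι : Type*} [DecidableEq ι] (p q : ι × Bool) : ℝ :=
  if p.1 = q.1 then (if p.2 = q.2 then 0 else if p.2 then -1 else 1) else 0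

/-- A nonzero term requires $\tau$ to map pairs to pairs. Then $\tau$ permutes the pairs by `π` and
flips some of them by `φ`. The permutation of pairs acts on both members and so is even, while the
product of the form equals the product of the signs of the flips; the term is a product of squares.
-/
theorem sign_mul_prod_stdForm_nonneg {ι : Type*} [DecidableEq ι] [Fintype ι]
    (τ : Equiv.Perm (ι × Bool)) :
    0 ≤ ((Equiv.Perm.sign τ : ℤ) : ℝ) * ∏ k, stdForm (τ (k, false)) (τ (k, true)) := by
  by_cases h : ∀ k, stdForm (τ (k, false)) (τ (k, true)) ≠ 0
  swap
  · push Not at h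
    obtain ⟨k, hk⟩ := h
    rw [Finset.prod_eq_zero (Finset.mem_univ k) hk, mul_zero]
  have h1 : ∀ k, (τ (k, false)).1 = (τ (k, true)).1 := fun k => by
    by_contra hne
    exact h k (by simp [stdForm, hne])
  have h2 : ∀ k, (τ (k, false)).2 ≠ (τ (k, true)).2 := fun k heq => h k (by simp [stdForm, heq])
  have h1' : ∀ k b, (τ (k, b)).1 = (τ (k, true)).1 := by
    rintro k (_ | _)
    exacts [h1 k, rfl]
  have hinj : Function.Injective fun k => (τ (k, true)).1 := by
    intro k l hkl
    simp only at hkl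
    have : ∃ b, (τ (l, b)).2 = (τ (k, true)).2 := by
      have := h2 l
      by_cases hb : (τ (l, true)).2 = (τ (k, true)).2
      · exact ⟨true, hb⟩
      · refine ⟨false, ?_⟩
        revert this hb
        generalize (τ (l, true)).2 = a, (τ (k, true)).2 = b, (τ (l, false)).2 = c
        revert a b c
        decide
    obtain ⟨b, hb⟩ := this
    have := τ.injective (Prod.ext ((h1' l b).trans hkl.symm) hb)
    exact (congrArg Prod.fst this).symm
  let π : Equiv.Perm ι := Equiv.ofBijective _ (Finite.injective_iff_bijective.1 hinj)
  have hflip : ∀ k, Function.Injective fun b => (τ (k, b)).2 := by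
    rintro k (_ | _) (_ | _) hab
    · rfl
    · exact absurd hab (h2 k)
    · exact absurd hab.symm (h2 k)
    · rfl
  let φ : ι → Equiv.Perm Bool := fun k =>
    Equiv.ofBijective _ (Finite.injective_iff_bijective.1 (hflip k))
  have hτ : τ = Equiv.prodCongrLeft (fun _ : Bool => π) * Equiv.prodCongrRight φ := by
    ext1 ⟨k, b⟩
    exact Prod.ext (h1' k b) rfl
  have hφ : ∀ k, stdForm (τ (k, false)) (τ (k, true)) = ((Equiv.Perm.sign (φ k) : ℤ) : ℝ) := by
    intro k
    have hc : φ k = 1 ∨ φ k = Equiv.swap false true := by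
      generalize φ k = f
      revert f
      decide
    have e1 : (τ (k, false)).2 = φ k false := rfl
    have e2 : (τ (k, true)).2 = φ k true := rfl
    rw [stdForm, if_pos (h1 k), e1, e2]
    rcases hc with hc | hc <;> simp [hc]
  rw [Finset.prod_congr rfl fun k _ => hφ k]
  nth_rewrite 1 [hτ]
  rw [map_mul, Equiv.Perm.sign_prodCongrLeft, Equiv.Perm.sign_prodCongrRight]
  have hsq : ∀ u : ℤˣ, ((u : ℤ) : ℝ) * ((u : ℤ) : ℝ) = 1 := fun u => by
    rcases Int.units_eq_one_or u with rfl | rfl <;> norm_num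
  have : ((∏ k, Equiv.Perm.sign (φ k) : ℤˣ) : ℤ) = ∏ k, (Equiv.Perm.sign (φ k) : ℤ) :=
    map_prod (Units.coeHom ℤ) _ _
  simp only [Fintype.prod_bool, Int.units_mul_self, one_mul]
  rw [this]
  push_cast
  rw [← Finset.prod_mul_distrib]
  exact Finset.prod_nonneg fun k _ => by rw [hsq]; exact zero_le_one

/-- Pairs of indices of `Fin n`. -/
def pairEquiv (hn : Even n) : Fin (n / 2) × Bool ≃ Fin n :=
  Equiv.ofBijective (fun p => if p.2 then pairSnd p.1 else pairFst p.1) <| by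
    constructor
    · rintro ⟨k, _ | _⟩ ⟨l, _ | _⟩ h
      · simpa [pairFst_inj] using h
      · exact absurd h (pairFst_ne_pairSnd _ _)
      · exact absurd h.symm (pairFst_ne_pairSnd _ _)
      · simpa [pairSnd_inj] using h
    · intro l
      obtain ⟨k, h | h⟩ := eq_pairFst_or_eq_pairSnd hn l
      · exact ⟨(k, false), by simp [h]⟩
      · exact ⟨(k, true), by simp [h]⟩

/-- The block diagonal antisymmetric form with first block `±r` and other blocks `±1`. -/
def blockForm (hn : Even n) (r : ℝ) (i j : Fin n) : ℝ :=
  (if ((pairEquiv hn).symm i).1.1 = 0 then r else 1) *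
    stdForm ((pairEquiv hn).symm i) ((pairEquiv hn).symm j)

theorem stdForm_antisymm {ι : Type*} [DecidableEq ι] (p q : ι × Bool) :
    stdForm q p = -stdForm p q := by
  obtain ⟨k, a⟩ := p
  obtain ⟨l, b⟩ := q
  by_cases h : k = l
  · subst h
    cases a <;> cases b <;> simp [stdForm]
  · simp [stdForm, h, Ne.symm h]

theorem blockForm_antisymm (hn : Even n) (r : ℝ) (i j : Fin n) :
    blockForm hn r j i = -blockForm hn r i j := by
  unfold blockForm
  rw [stdForm_antisymm, mul_neg]
  by_cases h : ((pairEquiv hn).symm i).1 = ((pairEquiv hn).symm j).1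
  · rw [h]
  · simp [stdForm, h]

/-- No term is negative, so there is no cancellation, and the identity permutation contributes $1$.
-/
theorem pfaffian_blockForm_one_pos (hn : Even n) : 0 < pfaffian (blockForm hn 1) := by
  have hterm : ∀ σ : Equiv.Perm (Fin n), ((Equiv.Perm.sign σ : ℤ) : ℝ) *
      ∏ k : Fin (n / 2), blockForm hn 1 (σ (pairFst k)) (σ (pairSnd k)) =
      ((Equiv.Perm.sign ((pairEquiv hn).symm.permCongr σ) : ℤ) : ℝ) *
        ∏ k, stdForm ((pairEquiv hn).symm.permCongr σ (k, false))
          ((pairEquiv hn).symm.permCongr σ (k, true)) := by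
    intro σ
    rw [Equiv.Perm.sign_permCongr]
    congr 1
    refine Finset.prod_congr rfl fun k _ => ?_
    have e1 : pairEquiv hn (k, false) = pairFst k := rfl
    have e2 : pairEquiv hn (k, true) = pairSnd k := rfl
    simp [blockForm, e1, e2]
  refine Finset.sum_pos' (fun σ _ => ?_) ⟨1, Finset.mem_univ _, ?_⟩
  · rw [hterm]
    exact sign_mul_prod_stdForm_nonneg _
  · rw [hterm]
    have : (pairEquiv hn).symm.permCongr 1 = 1 := by ext1; simp
    rw [this]
    simp [stdForm]

/-- The form with parameter $r$ is the congruence of the one with parameter $1$ by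
$\operatorname{diag}(r,1,\dots,1)$. -/
theorem pfaffian_blockForm (hn : Even n) (h2 : 1 < n) (r : ℝ) :
    pfaffian (blockForm hn r) = r * pfaffian (blockForm hn 1) := by
  let d : Fin n → ℝ := fun i => if i.1 = 0 then r else 1
  have h := pfaffian_congruence hn (Matrix.diagonal d) (blockForm hn 1)
  have hdet : (Matrix.of (Matrix.diagonal d)).det = r := by
    change (Matrix.diagonal d).det = r
    rw [Matrix.det_diagonal, Finset.prod_eq_single ⟨0, by omega⟩]
    · simp [d]
    · intro b _ hb
      have : b.1 ≠ 0 := fun h0 => hb (Fin.ext h0)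
      simp [d, this]
    · simp
  rw [hdet] at h
  rw [← h]
  congr 1
  funext i j
  have : ∑ k, ∑ l, Matrix.diagonal d k i * blockForm hn 1 k l * Matrix.diagonal d l j =
      d i * blockForm hn 1 i j * d j := by
    simp [Matrix.diagonal_apply]
  rw [this]
  obtain ⟨⟨k, a⟩, rfl⟩ := (pairEquiv hn).surjective i
  obtain ⟨⟨l, b⟩, rfl⟩ := (pairEquiv hn).surjective j
  simp only [blockForm, Equiv.symm_apply_apply, stdForm, d]
  have e1 : ∀ k, pairEquiv hn (k, false) = pairFst k := fun _ => rfl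
  have e2 : ∀ k, pairEquiv hn (k, true) = pairSnd k := fun _ => rfl
  by_cases hkl : k = l
  · subst hkl
    cases a <;> cases b <;> by_cases hk : k.1 = 0 <;> simp [e1, e2, pairFst, pairSnd, hk]
  · simp [hkl]

/-- The segment from parameter $0$ to parameter $1$ consists of the block forms themselves, and
along it the Pfaffian is linear. -/
theorem fderiv_pfaffian_blockForm (hn : Even n) (h2 : 1 < n) :
    fderiv ℝ pfaffian (blockForm hn 0) (blockForm hn 1 - blockForm hn 0) =
      pfaffian (blockForm hn 1) := by
  have hc : HasDerivAt (fun ε : ℝ => blockForm hn 0 + ε • (blockForm hn 1 - blockForm hn 0))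
      (blockForm hn 1 - blockForm hn 0) 0 := by
    simpa using ((hasDerivAt_id (0 : ℝ)).smul_const
      (blockForm hn 1 - blockForm hn 0)).const_add (blockForm hn 0)
  have h1 := HasFDerivAt.comp_hasDerivAt_of_eq (0 : ℝ) (hasFDerivAt_pfaffian (blockForm hn 0)) hc
    (by simp)
  have h3 : (pfaffian ∘ fun ε : ℝ => blockForm hn 0 + ε • (blockForm hn 1 - blockForm hn 0)) =
      fun ε => ε * pfaffian (blockForm hn 1) := by
    funext ε
    rw [← pfaffian_blockForm hn h2, Function.comp_apply]
    congr 1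
    funext i j
    simp only [blockForm, Pi.add_apply, Pi.smul_apply, Pi.sub_apply, smul_eq_mul]
    split_ifs <;> ring
  rw [h3] at h1
  have := h1.unique ((hasDerivAt_id (0 : ℝ)).mul_const (pfaffian (blockForm hn 1)))
  simpa using this

/-- The missing block is $e_0\wedge e_1$. Both a velocity variation along $e_0$ and the baroclinic
source of a stratified field produce multiples of it. -/
theorem blockForm_one_sub_blockForm_zero (hn : Even n) (i j : Fin n) :
    (blockForm hn 1 - blockForm hn 0) i j =
      (if i.1 = 0 then 1 else 0) * (if j.1 = 1 then 1 else 0) -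
        (if j.1 = 0 then 1 else 0) * (if i.1 = 1 then 1 else 0) := by
  obtain ⟨⟨k, a⟩, rfl⟩ := (pairEquiv hn).surjective i
  obtain ⟨⟨l, b⟩, rfl⟩ := (pairEquiv hn).surjective j
  have e1 : ∀ k, pairEquiv hn (k, false) = pairFst k := fun _ => rfl
  have e2 : ∀ k, pairEquiv hn (k, true) = pairSnd k := fun _ => rfl
  have hne : ∀ x : ℕ, 2 * x ≠ 1 := fun x => by omega
  simp only [Pi.sub_apply, blockForm, Equiv.symm_apply_apply, stdForm]
  by_cases hkl : k = l
  · subst hkl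
    cases a <;> cases b <;> by_cases hk : k.1 = 0 <;> simp [e1, e2, pairFst, pairSnd, hk, hne]
  · have hkl' : ¬ (k.1 = 0 ∧ l.1 = 0) := fun h => hkl (Fin.ext (h.1.trans h.2.symm))
    by_cases hk : k.1 = 0
    · have hl : l.1 ≠ 0 := fun h => hkl' ⟨hk, h⟩
      cases a <;> cases b <;> simp [e1, e2, pairFst, pairSnd, hk, hl, hkl, hne]
    · cases a <;> cases b <;> simp [e1, e2, pairFst, pairSnd, hk, hkl, hne]

/-- The components `ε^{i j₁k₁⋯jₘkₘ} M_{j₁k₁}⋯M_{jₘkₘ}` for `n = 2m + 1`. -/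
def pfaffianVec (M : Fin n → Fin n → ℝ) : Space n := fun i =>
  ∑ σ : Equiv.Perm (Fin n) with (σ.symm i).1 = 0, ((Equiv.Perm.sign σ : ℤ) : ℝ) *
    ∏ k : Fin ((n - 1) / 2),
      M (σ ⟨2 * k.1 + 1, by have := k.2; omega⟩) (σ ⟨2 * k.1 + 2, by have := k.2; omega⟩)

theorem contDiff_pfaffianVec {k : WithTop ℕ∞} : ContDiff ℝ k (pfaffianVec (n := n)) := by
  unfold pfaffianVec
  refine contDiff_pi.2 fun i =>
    ContDiff.sum fun σ _ => contDiff_const.mul (contDiff_prod fun k _ => ?_)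
  fun_prop

theorem pfaffianVec_smul (c : ℝ) (M : Fin n → Fin n → ℝ) :
    pfaffianVec (c • M) = c ^ ((n - 1) / 2) • pfaffianVec M := by
  funext i
  simp only [pfaffianVec, Pi.smul_apply, smul_eq_mul, Finset.prod_mul_distrib, Finset.prod_const,
    Finset.card_univ, Fintype.card_fin, Finset.mul_sum]
  exact Finset.sum_congr rfl fun σ _ => by ring

/-! ### Partial derivatives -/

theorem HasFDerivAt.partialDeriv_eq {f : Space n → ℝ} {f' : Space n →L[ℝ] ℝ} {x : Space n}
    (h : HasFDerivAt f f' x) (i : Fin n) : partialDeriv i f x = f' (Pi.single i 1) := by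
  rw [partialDeriv, h.fderiv]

theorem partialDeriv_congr {f g : Space n → ℝ} {x : Space n} (h : f =ᶠ[𝓝 x] g) (i : Fin n) :
    partialDeriv i f x = partialDeriv i g x := by
  rw [partialDeriv, partialDeriv, h.fderiv_eq]

theorem partialDeriv_const (c : ℝ) (x : Space n) (i : Fin n) :
    partialDeriv i (fun _ => c) x = 0 := by
  simp [partialDeriv]

theorem partialDeriv_coord (x : Space n) (i j : Fin n) :
    partialDeriv i (fun y => y j) x = if i = j then 1 else 0 := by
  rw [HasFDerivAt.partialDeriv_eq (hasFDerivAt_apply j x)]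
  simp [Pi.single_apply, eq_comm]

theorem partialDeriv_add {f g : Space n → ℝ} {x : Space n} (hf : DifferentiableAt ℝ f x)
    (hg : DifferentiableAt ℝ g x) (i : Fin n) :
    partialDeriv i (fun y => f y + g y) x = partialDeriv i f x + partialDeriv i g x := by
  rw [HasFDerivAt.partialDeriv_eq (hf.hasFDerivAt.fun_add hg.hasFDerivAt)]
  rfl

theorem partialDeriv_sub {f g : Space n → ℝ} {x : Space n} (hf : DifferentiableAt ℝ f x)
    (hg : DifferentiableAt ℝ g x) (i : Fin n) :
    partialDeriv i (fun y => f y - g y) x = partialDeriv i f x - partialDeriv i g x := by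
  rw [HasFDerivAt.partialDeriv_eq (hf.hasFDerivAt.fun_sub hg.hasFDerivAt)]
  rfl

theorem partialDeriv_neg {f : Space n → ℝ} {x : Space n} (i : Fin n) :
    partialDeriv i (fun y => -f y) x = -partialDeriv i f x := by
  simp [partialDeriv, fderiv_fun_neg]

theorem partialDeriv_mul {f g : Space n → ℝ} {x : Space n} (hf : DifferentiableAt ℝ f x)
    (hg : DifferentiableAt ℝ g x) (i : Fin n) :
    partialDeriv i (fun y => f y * g y) x =
      f x * partialDeriv i g x + partialDeriv i f x * g x := by
  rw [HasFDerivAt.partialDeriv_eq (hf.hasFDerivAt.fun_mul hg.hasFDerivAt)]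
  simp [partialDeriv, mul_comm]

theorem partialDeriv_const_mul {f : Space n → ℝ} {x : Space n} (hf : DifferentiableAt ℝ f x)
    (c : ℝ) (i : Fin n) :
    partialDeriv i (fun y => c * f y) x = c * partialDeriv i f x := by
  rw [partialDeriv_mul (differentiableAt_const c) hf, partialDeriv_const, zero_mul, add_zero]

theorem partialDeriv_sum {ι : Type*} {s : Finset ι} {f : ι → Space n → ℝ} {x : Space n}
    (hf : ∀ k ∈ s, DifferentiableAt ℝ (f k) x) (i : Fin n) :
    partialDeriv i (fun y => ∑ k ∈ s, f k y) x = ∑ k ∈ s, partialDeriv i (f k) x := by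
  rw [HasFDerivAt.partialDeriv_eq (HasFDerivAt.fun_sum fun k hk => (hf k hk).hasFDerivAt)]
  simp [partialDeriv]

theorem _root_.ContDiffAt.partialDeriv {f : Space n → ℝ} {x : Space n}
    (hf : ContDiffAt ℝ ∞ f x) (i : Fin n) :
    ContDiffAt ℝ ∞ (Fluid.partialDeriv i f) x :=
  (hf.fderiv_right (m := ∞) (by simp)).clm_apply contDiffAt_const

theorem partialDeriv_comm {f : Space n → ℝ} {x : Space n} (hf : ContDiffAt ℝ ∞ f x)
    (i j : Fin n) :
    partialDeriv i (partialDeriv j f) x = partialDeriv j (partialDeriv i f) x := by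
  have hd : DifferentiableAt ℝ (fderiv ℝ f) x :=
    (hf.fderiv_right (m := ∞) (by simp)).differentiableAt (by simp)
  have key : ∀ a b : Fin n, partialDeriv a (partialDeriv b f) x =
      fderiv ℝ (fderiv ℝ f) x (Pi.single a 1) (Pi.single b 1) := by
    intro a b
    have : HasFDerivAt (partialDeriv b f) _ x :=
      hd.hasFDerivAt.clm_apply (hasFDerivAt_const (Pi.single b (1 : ℝ) : Space n) x)
    rw [HasFDerivAt.partialDeriv_eq this]
    simp
  rw [key, key]
  exact (hf.isSymmSndFDerivAt (by simp; exact WithTop.coe_le_coe.2 le_top)).eq _ _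

/-! ### Affine velocity fields -/

/-- The fields with velocity `u + A x` and constant density and entropy. -/
def affineField (ρ s : ℝ) (u : Space n) (A : Fin n → Fin n → ℝ) : Fields n := fun x =>
  (fun i => u i + ∑ j, A i j * x j, ρ, s)

theorem contDiff_affineField (ρ s : ℝ) (u : Space n) (A : Fin n → Fin n → ℝ)
    {k : WithTop ℕ∞} : ContDiff ℝ k (affineField ρ s u A) := by
  unfold affineField
  fun_prop

theorem isConstEntropyAt_affineField {ρ : ℝ} (hρ : 0 < ρ) (s : ℝ) (u : Space n)
    (A : Fin n → Fin n → ℝ) (x : Space n) : IsConstEntropyAt s (affineField ρ s u A) x :=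
  ⟨⟨Filter.Eventually.of_forall fun _ => (contDiff_affineField ρ s u A).contDiffAt, hρ⟩,
    Filter.Eventually.of_forall fun _ => rfl⟩

theorem partialDeriv_velocity_affineField (ρ s : ℝ) (u : Space n) (A : Fin n → Fin n → ℝ)
    (x : Space n) (i j : Fin n) :
    partialDeriv j (fun y => velocity (affineField ρ s u A) y i) x = A i j := by
  simp only [velocity, affineField]
  rw [partialDeriv_add (by fun_prop) (by fun_prop), partialDeriv_const,
    partialDeriv_sum (fun k _ => by fun_prop)]
  simp_rw [partialDeriv_const_mul (differentiableAt_apply _ x), partialDeriv_coord]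
  simp

theorem curl_affineField (ρ s : ℝ) (u : Space n) (A : Fin n → Fin n → ℝ) (x : Space n) :
    curl (affineField ρ s u A) x = fun i j => (A i j - A j i) / 2 := by
  funext i j
  simp only [curl, partialDeriv_velocity_affineField]

/-- With constant density and entropy there is no pressure gradient, and $\mathbf
u\cdot\nabla\mathbf u$ is affine when $\mathbf u$ is. The class of fields is therefore preserved,
and `evolDeriv` becomes a derivative along a curve of parameters. -/
theorem eulerRHS_affineField (P : ℝ → ℝ → ℝ) (ρ s : ℝ) (u : Space n) (A : Fin n → Fin n → ℝ)
    (ε : ℝ) :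
    affineField ρ s u A + ε • eulerRHS P (affineField ρ s u A) =
      affineField (ρ - ε * (ρ * ∑ i, A i i)) s (fun i => u i - ε * ∑ j, A i j * u j)
        (fun i j => A i j - ε * ∑ k, A i k * A k j) := by
  funext x
  have hρ : ∀ i, partialDeriv i (fun y => P (density (affineField ρ s u A) y)
      (entropy (affineField ρ s u A) y)) x = 0 := fun i => partialDeriv_const (P ρ s) x i
  have hs : ∀ i, partialDeriv i (entropy (affineField ρ s u A)) x = 0 :=
    fun i => partialDeriv_const s x i
  have hdiv : divergence (fun y => density (affineField ρ s u A) y •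
      velocity (affineField ρ s u A) y) x = ρ * ∑ i, A i i := by
    rw [divergence, Finset.mul_sum]
    refine Finset.sum_congr rfl fun i _ => ?_
    have hd : DifferentiableAt ℝ (fun y => velocity (affineField ρ s u A) y i) x := by
      simp only [velocity, affineField]
      fun_prop
    have := partialDeriv_const_mul hd ρ i
    rw [partialDeriv_velocity_affineField] at this
    exact this
  refine Prod.ext ?_ (Prod.ext ?_ ?_)
  · funext i
    simp only [Pi.add_apply, Pi.smul_apply, Prod.fst_add, Prod.smul_fst, eulerRHS, hρ,
      partialDeriv_velocity_affineField, smul_eq_mul]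
    simp only [affineField, velocity, add_mul, sub_mul, Finset.sum_add_distrib,
      Finset.sum_sub_distrib, mul_zero, sub_zero, Finset.mul_sum, Finset.sum_mul, mul_neg, mul_add]
    rw [Finset.sum_comm (γ := Fin n)]
    simp only [mul_comm, mul_left_comm]
    ring
  · simp only [Pi.add_apply, Pi.smul_apply, Prod.snd_add, Prod.smul_snd, Prod.fst_add,
      Prod.smul_fst, eulerRHS, hdiv, smul_eq_mul, affineField]
    ring
  · simp only [Pi.add_apply, Pi.smul_apply, Prod.snd_add, Prod.smul_snd, eulerRHS, hs,
      smul_eq_mul, affineField]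
    simp

/-- The continuity equation evaluated on fields with constant density and entropy and velocity
gradient `M + 1`, where `M` is antisymmetric. -/
theorem flux_affineField {P : ℝ → ℝ → ℝ} {s : ℝ} {T : ℝ → Fields n → Space n → ℝ}
    (hT : HasZeroMovingFlux P (IsConstEntropyAt s) T)
    {Z : Type*} [NormedAddCommGroup Z] [NormedSpace ℝ Z] {Φ : (Fin n → Fin n → ℝ) → Z} {m : ℕ}
    (hΦ : ∀ (c : ℝ) M, Φ (c • M) = c ^ m • Φ M)
    {F : ℝ × ℝ × Space n × Z → ℝ} (hF : ContDiffOn ℝ ∞ F {q | 0 < q.1})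
    (hTF : ∀ t U x, IsConstEntropyAt s U x →
      T t U x = F (density U x, entropy U x, velocity U x, Φ (curl U x)))
    {ρ : ℝ} (hρ : 0 < ρ) (u : Space n) {M : Fin n → Fin n → ℝ} (hM : ∀ i j, M j i = -M i j) :
    n * (F (ρ, s, u, Φ M) - ρ * fderiv ℝ F (ρ, s, u, Φ M) (1, 0, 0, 0)) =
      2 * m * fderiv ℝ F (ρ, s, u, Φ M) (0, 0, 0, Φ M) := by
  set p : ℝ × ℝ × Space n × Z := (ρ, s, u, Φ M) with hp
  have hopen : IsOpen {q : ℝ × ℝ × Space n × Z | 0 < q.1} := isOpen_lt continuous_const continuous_fst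
  have hFd : HasFDerivAt F (fderiv ℝ F p) p :=
    ((hF.contDiffAt (hopen.mem_nhds hρ)).differentiableAt (by simp)).hasFDerivAt
  set D := fderiv ℝ F p
  -- The identity part provides divergence $n$ and, through $A^2=M^2+2M+1$, makes the curl decay at
  -- a definite rate.
  let A : Fin n → Fin n → ℝ := fun i j => M i j + if i = j then 1 else 0
  have hdiag : ∀ i, M i i = 0 := fun i => by linarith [hM i i]
  have htr : ∑ i, A i i = n := by simp [A, hdiag]
  have hcurl0 : ∀ x, curl (affineField ρ s u A) x = M := by
    intro x
    rw [curl_affineField]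
    funext i j
    simp only [A, eq_comm (a := j) (b := i)]
    rw [hM i j]
    ring
  -- $M^2$ is symmetric for antisymmetric $M$, so only $2M$ contributes to the antisymmetric part of
  -- $A^2$.
  have hcurl : ∀ ε : ℝ, (fun i j => ((A i j - ε * ∑ k, A i k * A k j) -
      (A j i - ε * ∑ k, A j k * A k i)) / 2) = (1 - 2 * ε) • M := by
    intro ε
    funext i j
    have e : ∀ i j, ∑ k, A i k * A k j = (∑ k, M i k * M k j) + 2 * M i j +
        if i = j then 1 else 0 := by
      intro i j
      simp only [A, add_mul, mul_add, Finset.sum_add_distrib]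
      simp
      ring
    have e2 : ∑ k, M j k * M k i = ∑ k, M i k * M k j :=
      Finset.sum_congr rfl fun k _ => by rw [hM k j, hM i k]; ring
    rw [e, e, e2]
    simp only [A, Pi.smul_apply, smul_eq_mul, eq_comm (a := j) (b := i)]
    rw [hM i j]
    ring
  have hevol : evolDeriv P T 0 (affineField ρ s u A) 0 =
      D (-(ρ * n), 0, fun i => -∑ j, A i j * u j, (-(2 * m : ℝ)) • Φ M) := by
    have hγ : HasDerivAt (fun ε : ℝ => ((ρ - ε * (ρ * n), s, fun i => u i - ε * ∑ j, A i j * u j,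
        (1 - 2 * ε) ^ m • Φ M) : ℝ × ℝ × Space n × Z))
        (-(ρ * n), 0, fun i => -∑ j, A i j * u j, (-(2 * m : ℝ)) • Φ M) 0 := by
      refine HasDerivAt.prodMk ?_ (HasDerivAt.prodMk (hasDerivAt_const _ _)
        (HasDerivAt.prodMk (hasDerivAt_pi.2 fun i => ?_) ?_))
      · simpa using ((hasDerivAt_id (0 : ℝ)).mul_const (ρ * n)).const_sub ρ
      · simpa using ((hasDerivAt_id (0 : ℝ)).mul_const (∑ j, A i j * u j)).const_sub (u i)
      · have h := ((((hasDerivAt_id (0 : ℝ)).const_mul 2).const_sub 1).pow m).smul_const (Φ M)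
        refine h.congr_deriv ?_
        simp
        congr 1
        ring
    have h1 := HasFDerivAt.comp_hasDerivAt_of_eq (0 : ℝ) hFd hγ (by simp [p])
    rw [← h1.deriv, evolDeriv]
    refine Filter.EventuallyEq.deriv_eq ?_
    have hpos : ∀ᶠ ε : ℝ in 𝓝 0, 0 < ρ - ε * (ρ * n) := by
      have : Continuous fun ε : ℝ => ρ - ε * (ρ * n) := by fun_prop
      exact this.continuousAt.eventually (lt_mem_nhds (by simpa using hρ))
    filter_upwards [hpos] with ε hε
    rw [eulerRHS_affineField, htr, hTF _ _ _ (isConstEntropyAt_affineField hε _ _ _ _),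
      curl_affineField, hcurl, hΦ]
    simp [affineField, density, entropy, velocity]
  have hdiv : divergence (fun y => T 0 (affineField ρ s u A) y •
      velocity (affineField ρ s u A) y) 0 =
      D (0, 0, fun i => ∑ j, A i j * u j, 0) + n * F p := by
    have hT' : ∀ y, T 0 (affineField ρ s u A) y =
        F (ρ, s, fun i => u i + ∑ j, A i j * y j, Φ M) := by
      intro y
      rw [hTF _ _ _ (isConstEntropyAt_affineField hρ _ _ _ _), hcurl0]
      rfl
    let ℓ : Space n →L[ℝ] ℝ × ℝ × Space n × Z :=
      (0 : Space n →L[ℝ] ℝ).prod ((0 : Space n →L[ℝ] ℝ).prod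
        ((ContinuousLinearMap.pi fun i => ∑ j, A i j • ContinuousLinearMap.proj j).prod 0))
    have hg : HasFDerivAt (fun y : Space n => ((ρ, s, fun i => u i + ∑ j, A i j * y j, Φ M) :
        ℝ × ℝ × Space n × Z)) ℓ 0 := by
      refine HasFDerivAt.prodMk (hasFDerivAt_const _ _) (HasFDerivAt.prodMk (hasFDerivAt_const _ _)
        (HasFDerivAt.prodMk (hasFDerivAt_pi.2 fun i => ?_) (hasFDerivAt_const _ _)))
      refine HasFDerivAt.const_add _ (HasFDerivAt.fun_sum fun j _ => ?_)
      exact (hasFDerivAt_apply j (0 : Space n)).const_mul (A i j)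
    have hfg := HasFDerivAt.comp (0 : Space n) (by simpa [p] using! hFd) hg
    have hterm : ∀ i, partialDeriv i (fun y => (T 0 (affineField ρ s u A) y •
        velocity (affineField ρ s u A) y) i) 0 = u i * D (ℓ (Pi.single i 1)) + F p * A i i := by
      intro i
      have hv : DifferentiableAt ℝ (fun y => velocity (affineField ρ s u A) y i) 0 := by
        simp only [velocity, affineField]
        fun_prop
      simp only [hT', Pi.smul_apply, smul_eq_mul]
      rw [partialDeriv_mul (f := fun y => F (ρ, s, fun i => u i + ∑ j, A i j * y j, Φ M))
        hfg.differentiableAt hv, partialDeriv_velocity_affineField]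
      have := HasFDerivAt.partialDeriv_eq hfg i
      rw [show partialDeriv i (fun y => F (ρ, s, fun i => u i + ∑ j, A i j * y j, Φ M)) 0 =
        D (ℓ (Pi.single i 1)) from this]
      simp [velocity, affineField, p]
      ring
    rw [divergence, Finset.sum_congr rfl fun i _ => hterm i, Finset.sum_add_distrib,
      ← Finset.mul_sum, htr, mul_comm (F p)]
    congr 1
    have : ∑ i, u i * D (ℓ (Pi.single i 1)) = D (ℓ (∑ i, u i • Pi.single i 1)) := by
      simp [map_sum]
    rw [this]
    congr 1
    have hu : ∑ i, u i • (Pi.single i 1 : Space n) = u := by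
      funext j
      simp [Finset.sum_apply, Pi.single_apply]
    rw [hu]
    simp only [ℓ, ContinuousLinearMap.prod_apply, zero_apply]
    congr 3
    funext i
    simp
  have := hT 0 (affineField ρ s u A) 0 (isConstEntropyAt_affineField hρ _ _ _ _)
  rw [hevol, hdiv] at this
  -- The acceleration $-A\mathbf u$ isolated here cancels the advection term in `hdiv`, so no
  -- velocity derivative of $F$ remains.
  have hsplit : D (-(ρ * n), 0, fun i => -∑ j, A i j * u j, (-(2 * m : ℝ)) • Φ M) =
      -(ρ * n) * D (1, 0, 0, 0) - D (0, 0, fun i => ∑ j, A i j * u j, 0) -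
        2 * m * D (0, 0, 0, Φ M) := by
    rw [← smul_eq_mul (-(ρ * n)), ← smul_eq_mul (2 * (m : ℝ)), ← map_smul, ← map_smul, ← map_sub,
      ← map_sub]
    congr 1
    refine Prod.ext ?_ (Prod.ext ?_ (Prod.ext ?_ ?_))
    · simp
    · simp
    · funext i
      simp
    · simp
  rw [hsplit] at this
  linarith

/-! ### Variations of integrals of divergences -/

theorem isOpen_pos_fst {E : Type*} [TopologicalSpace E] : IsOpen {q : ℝ × E | 0 < q.1} :=
  isOpen_lt continuous_const continuous_fst

theorem contDiffAt_localVector {𝒜 : Fields n → Space n → Prop}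
    {Θ : ℝ → Fields n → Space n → Space n} (hΘ : IsLocalVector 𝒜 Θ) {U : Fields n} {x : Space n}
    (hU : IsRegularAt U x) (h𝒜 : ∀ᶠ y in 𝓝 x, 𝒜 U y) (t : ℝ) : ContDiffAt ℝ ∞ (Θ t U) x := by
  obtain ⟨k, L, hL, hΘL⟩ := hΘ
  have hopen : IsOpen {q : ℝ × Space n × Phase n × Derivs n k | 0 < q.2.2.1.2.1} :=
    isOpen_lt continuous_const (by fun_prop)
  have hUx : ContDiffAt ℝ ∞ U x := hU.1.self_of_nhds
  have hd : ContDiffAt ℝ ∞ (fun y => (fun j => iteratedFDeriv ℝ (j.1 + 1) U y : Derivs n k)) x :=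
    contDiffAt_pi.2 fun j => hUx.iteratedFDeriv_right (i := j.1 + 1) (m := ∞)
      (by exact_mod_cast le_rfl)
  have hLx : ContDiffAt ℝ ∞ L (t, x, U x, fun j => iteratedFDeriv ℝ (j.1 + 1) U x) :=
    hL.contDiffAt (hopen.mem_nhds hU.2)
  have := hLx.comp x (contDiffAt_const.prodMk (contDiffAt_id.prodMk (hUx.prodMk hd)))
  exact this.congr_of_eventuallyEq (h𝒜.mono fun y hy => hΘL t U y hy)

/-- Integration by parts against the constant function $1$. -/
theorem integral_partialDeriv_eq_zero {f : Space n → ℝ} (hf : ContDiff ℝ 1 f)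
    (hc : HasCompactSupport f) (i : Fin n) : ∫ x, partialDeriv i f x = 0 := by
  have hd : Continuous fun x => fderiv ℝ f x (Pi.single i 1) :=
    (hf.continuous_fderiv (by simp)).clm_apply continuous_const
  have h := integral_mul_fderiv_eq_neg_fderiv_mul_of_integrable (μ := MeasureTheory.volume)
    (f := fun _ : Space n => (1 : ℝ)) (g := f) (v := Pi.single i 1) (by simp)
    (by simpa using! hd.integrable_of_hasCompactSupport (hc.fderiv_apply ℝ (Pi.single i 1)))
    (by simpa using hf.continuous.integrable_of_hasCompactSupport hc)
    (fun x _ => differentiableAt_const _) (fun x _ => hf.differentiable (by simp) x)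
  simpa using! h

/-- The integral of a total divergence is unchanged by compactly supported variations. -/
theorem integral_totalDiv_sub {𝒜 : Fields n → Space n → Prop}
    (h𝒜 : ∀ U x, 𝒜 U x → IsRegularAt U x) {Θ : ℝ → Fields n → Space n → Space n}
    (hΘ : IsLocalVector 𝒜 Θ) {U V : Fields n} (hU : ∀ x, 𝒜 U x) (hV : ∀ x, 𝒜 V x)
    (hUV : HasCompactSupport fun x => U x - V x) (t : ℝ) :
    ∫ x, (totalDiv Θ t U x - totalDiv Θ t V x) = 0 := by
  have hUs : ContDiff ℝ ∞ (Θ t U) := contDiff_iff_contDiffAt.2 fun x =>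
    contDiffAt_localVector hΘ (h𝒜 _ _ (hU x)) (Filter.Eventually.of_forall hU) t
  have hVs : ContDiff ℝ ∞ (Θ t V) := contDiff_iff_contDiffAt.2 fun x =>
    contDiffAt_localVector hΘ (h𝒜 _ _ (hV x)) (Filter.Eventually.of_forall hV) t
  have hYs : ∀ i, ContDiff ℝ 1 fun x => Θ t U x i - Θ t V x i := fun i =>
    ((contDiff_pi.1 hUs i).sub (contDiff_pi.1 hVs i)).of_le (by exact_mod_cast le_top)
  -- Where the two fields agree on a neighbourhood, all their derivatives agree, and so do the
  -- values of the local function.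
  have hYc : ∀ i, HasCompactSupport fun x => Θ t U x i - Θ t V x i := by
    intro i
    refine HasCompactSupport.intro hUV fun x hx => ?_
    have hev : U =ᶠ[𝓝 x] V := by
      filter_upwards [(isClosed_tsupport _).isOpen_compl.mem_nhds hx] with y hy
      exact sub_eq_zero.1 (image_eq_zero_of_notMem_tsupport (f := fun x => U x - V x) hy)
    obtain ⟨k, L, -, hΘL⟩ := hΘ
    have hd : (fun j : Fin k => iteratedFDeriv ℝ (j.1 + 1) U x) =
        fun j : Fin k => iteratedFDeriv ℝ (j.1 + 1) V x :=
      funext fun j => (hev.iteratedFDeriv ℝ (j.1 + 1)).self_of_nhds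
    rw [hΘL t U x (hU x), hΘL t V x (hV x), hev.self_of_nhds, hd, sub_self]
  have hsum : ∀ x, totalDiv Θ t U x - totalDiv Θ t V x =
      ∑ i, partialDeriv i (fun x => Θ t U x i - Θ t V x i) x := by
    intro x
    rw [totalDiv, totalDiv, divergence, divergence, ← Finset.sum_sub_distrib]
    refine Finset.sum_congr rfl fun i _ => (partialDeriv_sub ?_ ?_ i).symm
    · exact ((contDiff_pi.1 hUs i).differentiable (by simp)) x
    · exact ((contDiff_pi.1 hVs i).differentiable (by simp)) x
  simp_rw [hsum]
  rw [MeasureTheory.integral_finsetSum]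
  · exact Finset.sum_eq_zero fun i _ => integral_partialDeriv_eq_zero (hYs i) (hYc i) i
  · intro i _
    exact (((hYs i).continuous_fderiv (by simp)).clm_apply
      continuous_const).integrable_of_hasCompactSupport ((hYc i).fderiv_apply ℝ (Pi.single i 1))

/-- Differentiation under the integral sign: the $\varepsilon$-derivative vanishes off $K$ and is
bounded on $K$ for $\varepsilon$ in the compact interval $[-\delta/2,\delta/2]$. Subtracting `h 0 x`
keeps the integrand integrable, since $h$ itself need not decay. -/
theorem integral_deriv_eq_zero {h : ℝ → Space n → ℝ} {δ : ℝ} (hδ : 0 < δ)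
    (hh : ContDiffOn ℝ 1 (fun q : ℝ × Space n => h q.1 q.2) (Set.Ioo (-δ) δ ×ˢ Set.univ))
    {K : Set (Space n)} (hK : IsCompact K) (hc : ∀ ε, ∀ x ∉ K, h ε x = h 0 x)
    (hI : ∀ ε ∈ Set.Ioo (-δ) δ, ∫ x, (h ε x - h 0 x) = 0) :
    ∫ x, deriv (fun ε => h ε x) 0 = 0 := by
  have hopen : IsOpen (Set.Ioo (-δ) δ ×ˢ (Set.univ : Set (Space n))) := isOpen_Ioo.prod isOpen_univ
  have hd : ∀ ε ∈ Set.Ioo (-δ) δ, ∀ x, HasDerivAt (fun ε => h ε x)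
      (fderiv ℝ (fun q : ℝ × Space n => h q.1 q.2) (ε, x) (1, 0)) ε := by
    intro ε hε x
    have h1 : HasFDerivAt (fun q : ℝ × Space n => h q.1 q.2)
        (fderiv ℝ (fun q : ℝ × Space n => h q.1 q.2) (ε, x)) (ε, x) :=
      ((hh.contDiffAt (hopen.mem_nhds ⟨hε, trivial⟩)).differentiableAt (by simp)).hasFDerivAt
    have h2 : HasDerivAt (fun ε : ℝ => (ε, x)) (1, 0) ε :=
      (hasDerivAt_id ε).prodMk (hasDerivAt_const ε x)
    exact h1.comp_hasDerivAt ε h2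
  have hcont : ContinuousOn (fun q : ℝ × Space n =>
      fderiv ℝ (fun q : ℝ × Space n => h q.1 q.2) q (1, 0)) (Set.Ioo (-δ) δ ×ˢ Set.univ) :=
    (hh.continuousOn_fderiv_of_isOpen hopen le_rfl).clm_apply continuousOn_const
  have hsub : Set.Icc (-(δ / 2)) (δ / 2) ⊆ Set.Ioo (-δ) δ := fun y hy =>
    ⟨by linarith [hy.1], by linarith [hy.2]⟩
  obtain ⟨C, hC⟩ := ((isCompact_Icc (a := -(δ / 2)) (b := δ / 2)).prod hK).exists_bound_of_continuousOn
    (hcont.mono (Set.prod_mono hsub (Set.subset_univ _)))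
  have hslice : ∀ ε ∈ Set.Ioo (-δ) δ, Continuous fun x => h ε x := by
    intro ε hε
    exact hh.continuousOn.comp_continuous (f := fun x : Space n => (ε, x)) (by fun_prop)
      fun x => ⟨hε, trivial⟩
  have h0 : (0 : ℝ) ∈ Set.Ioo (-δ) δ := ⟨by linarith, hδ⟩
  have key := hasDerivAt_integral_of_dominated_loc_of_deriv_le (μ := MeasureTheory.volume)
    (F := fun ε x => h ε x - h 0 x) (x₀ := (0 : ℝ)) (s := Set.Icc (-(δ / 2)) (δ / 2))
    (F' := fun ε x => fderiv ℝ (fun q : ℝ × Space n => h q.1 q.2) (ε, x) (1, 0))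
    (bound := K.indicator fun _ => C)
    (Icc_mem_nhds (by linarith) (by linarith)) ?_ (by simp) ?_ ?_ ?_ ?_
  · have hz : HasDerivAt (fun ε => ∫ x, (h ε x - h 0 x)) 0 0 := by
      refine (hasDerivAt_const (0 : ℝ) (0 : ℝ)).congr_of_eventuallyEq ?_
      filter_upwards [Ioo_mem_nhds h0.1 h0.2] with ε hε using hI ε hε
    refine Eq.trans ?_ (key.2.unique hz)
    exact MeasureTheory.integral_congr_ae (Filter.Eventually.of_forall fun x => (hd 0 h0 x).deriv)
  · filter_upwards [Ioo_mem_nhds h0.1 h0.2] with ε hε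
    exact ((hslice ε hε).sub (hslice 0 h0)).aestronglyMeasurable
  · exact (hcont.comp_continuous (f := fun x : Space n => ((0 : ℝ), x)) (by fun_prop)
      fun x => ⟨h0, trivial⟩).aestronglyMeasurable
  · refine Filter.Eventually.of_forall fun x ε hε => ?_
    by_cases hx : x ∈ K
    · simpa [hx] using hC (ε, x) ⟨hε, hx⟩
    · have : HasDerivAt (fun ε => h ε x) 0 ε := by
        have e : (fun ε => h ε x) = fun _ => h 0 x := funext fun ε => hc ε x hx
        rw [e]
        exact hasDerivAt_const _ _
      rw [(hd ε (hsub hε) x).unique this]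
      simp [hx]
  · exact (MeasureTheory.integrableOn_const hK.measure_lt_top.ne).integrable_indicator
      hK.measurableSet
  · exact Filter.Eventually.of_forall fun x ε hε => (hd ε (hsub hε) x).sub_const _

/-- The fundamental lemma of the calculus of variations; continuity upgrades the almost-everywhere
conclusion to every point. -/
theorem eq_zero_of_forall_integral_mul_eq_zero {g : Space n → ℝ} (hg : Continuous g)
    (h : ∀ φ : Space n → ℝ, ContDiff ℝ ∞ φ → HasCompactSupport φ → ∫ x, φ x * g x = 0)
    (x : Space n) : g x = 0 := by
  have h1 := ae_eq_zero_of_integral_contDiff_smul_eq_zero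
    (hg.locallyIntegrable (μ := MeasureTheory.volume)) h
  have h2 := (hg.ae_eq_iff_eq (MeasureTheory.volume) continuous_const).1 h1
  exact congrFun h2 x

theorem curl_affineField_add (ρ s : ℝ) (u : Space n) (A : Fin n → Fin n → ℝ)
    {φ : Space n → ℝ} {x : Space n} (hφ : DifferentiableAt ℝ φ x) (e : Phase n) :
    curl (fun x => affineField ρ s u A x + φ x • e) x = fun i j => (A i j - A j i) / 2 +
      (e.1 i * partialDeriv j φ x - e.1 j * partialDeriv i φ x) / 2 := by
  have h : ∀ i j, partialDeriv j
      (fun y => velocity (fun x => affineField ρ s u A x + φ x • e) y i) x =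
      A i j + e.1 i * partialDeriv j φ x := by
    intro i j
    rw [← partialDeriv_velocity_affineField ρ s u A x i j, ← partialDeriv_const_mul hφ,
      ← partialDeriv_add _ (by fun_prop)]
    · refine partialDeriv_congr (Filter.Eventually.of_forall fun y => ?_) j
      simp [velocity, mul_comm]
    · simp only [velocity, affineField]
      fun_prop
  funext i j
  rw [curl, h, h]
  ring

/-- The first variation of `∫ F(ρ, S, u, Φ(ω))` about a field with affine velocity and constant
density and entropy vanishes if the integrand is a total divergence. -/
theorem integral_variation_eq_zero {𝒜 : Fields n → Space n → Prop}
    (h𝒜 : ∀ U x, 𝒜 U x → IsRegularAt U x) {Θ : ℝ → Fields n → Space n → Space n}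
    (hΘ : IsLocalVector 𝒜 Θ)
    {Z : Type*} [NormedAddCommGroup Z] [NormedSpace ℝ Z] {Φ : (Fin n → Fin n → ℝ) → Z}
    (hΦ : ContDiff ℝ ∞ Φ)
    {F : ℝ × ℝ × Space n × Z → ℝ} (hF : ContDiffOn ℝ ∞ F {q | 0 < q.1})
    (hTF : ∀ t U x, 𝒜 U x →
      totalDiv Θ t U x = F (density U x, entropy U x, velocity U x, Φ (curl U x)))
    {ρ : ℝ} (hρ : 0 < ρ) (s : ℝ) (u : Space n) (A : Fin n → Fin n → ℝ)
    {M : Fin n → Fin n → ℝ} (hM : ∀ i j, M i j = (A i j - A j i) / 2) (e : Phase n)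
    (hadm : ∀ φ : Space n → ℝ, ContDiff ℝ ∞ φ → (∀ x, 0 < ρ + φ x * e.2.1) →
      ∀ x, 𝒜 (fun x => affineField ρ s u A x + φ x • e) x)
    {φ : Space n → ℝ} (hφ : ContDiff ℝ ∞ φ) (hφc : HasCompactSupport φ) :
    ∫ x, fderiv ℝ F (ρ, s, fun i => u i + ∑ j, A i j * x j, Φ M)
      (φ x * e.2.1, φ x * e.2.2, φ x • e.1, fderiv ℝ Φ M fun i j =>
        (e.1 i * partialDeriv j φ x - e.1 j * partialDeriv i φ x) / 2) = 0 := by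
  obtain ⟨C, hC⟩ : ∃ C, ∀ x, ‖φ x * e.2.1‖ ≤ C :=
    (hφc.mul_right).exists_bound_of_continuous (by have := hφ.continuous; fun_prop)
  have hC0 : 0 ≤ C := (norm_nonneg _).trans (hC 0)
  set β : Space n → Fin n → Fin n → ℝ := fun x i j =>
    (e.1 i * partialDeriv j φ x - e.1 j * partialDeriv i φ x) / 2 with hβ
  have hβs : ContDiff ℝ ∞ β := by
    have hp : ∀ i, ContDiff ℝ ∞ (partialDeriv i φ) := fun i =>
      contDiff_iff_contDiffAt.2 fun x => hφ.contDiffAt.partialDeriv i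
    refine contDiff_pi.2 fun i => contDiff_pi.2 fun j => ?_
    have h1 := hp i
    have h2 := hp j
    fun_prop
  -- Since $C$ bounds the density perturbation, $|\varepsilon|<\delta$ keeps the density positive;
  -- the $+1$ covers $C=0$.
  set δ := ρ / (C + 1) with hδ
  have hδ0 : 0 < δ := by positivity
  have hpos : ∀ ε ∈ Set.Ioo (-δ) δ, ∀ x, 0 < ρ + ε * (φ x * e.2.1) := by
    intro ε hε x
    have h1 : |ε * (φ x * e.2.1)| ≤ |ε| * C := by
      rw [abs_mul]
      exact mul_le_mul_of_nonneg_left (hC x) (abs_nonneg _)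
    have h2 : |ε| < δ := abs_lt.2 hε
    have h3 : |ε| * (C + 1) < ρ := by rwa [hδ, lt_div_iff₀ (by positivity)] at h2
    have h4 := neg_abs_le (ε * (φ x * e.2.1))
    nlinarith [abs_nonneg ε]
  -- The arguments of $F$ on the varied field. The curl depends affinely on the velocity, hence is
  -- $M+\varepsilon\beta$.
  let c : ℝ → Space n → ℝ × ℝ × Space n × Z := fun ε x =>
    (ρ + ε * (φ x * e.2.1), s + ε * (φ x * e.2.2),
      fun i => (u i + ∑ j, A i j * x j) + ε * (φ x * e.1 i), Φ (M + ε • β x))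
  have hcs : ContDiff ℝ ∞ fun q : ℝ × Space n => c q.1 q.2 := by
    have h1 : ContDiff ℝ ∞ fun q : ℝ × Space n => φ q.2 := hφ.comp contDiff_snd
    have h2 : ContDiff ℝ ∞ fun q : ℝ × Space n => β q.2 := hβs.comp contDiff_snd
    have h3 : ContDiff ℝ ∞ fun q : ℝ × Space n => Φ (M + q.1 • β q.2) := hΦ.comp (by fun_prop)
    simp only [c]
    fun_prop
  have hTc : ∀ ε ∈ Set.Ioo (-δ) δ, ∀ x,
      totalDiv Θ 0 (fun x => affineField ρ s u A x + (ε * φ x) • e) x = F (c ε x) := by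
    intro ε hε x
    have hφ' : ContDiff ℝ ∞ fun x => ε * φ x := contDiff_const.mul hφ
    rw [hTF _ _ _ (hadm (fun x => ε * φ x) hφ' (fun x => by
      rw [mul_assoc]; exact hpos ε hε x) x), curl_affineField_add ρ s u A (φ := fun x => ε * φ x)
      (hφ'.differentiable (by simp) x)]
    congr 1
    refine Prod.ext ?_ (Prod.ext ?_ (Prod.ext ?_ ?_))
    · simp [density, affineField, c, mul_assoc]
    · simp [entropy, affineField, c, mul_assoc]
    · funext i
      simp [velocity, affineField, c, mul_assoc]
    · simp only [c]
      congr 1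
      funext i j
      have hd : DifferentiableAt ℝ φ x := hφ.differentiable (by simp) x
      simp only [partialDeriv_const_mul hd, hM, Pi.add_apply, Pi.smul_apply, smul_eq_mul, hβ]
      ring
  have key := integral_deriv_eq_zero (h := fun ε x => F (c ε x)) hδ0 ?_ hφc ?_ ?_
  · rw [← key]
    refine MeasureTheory.integral_congr_ae (Filter.Eventually.of_forall fun x => ?_)
    have hc : HasDerivAt (fun ε => c ε x)
        (φ x * e.2.1, φ x * e.2.2, φ x • e.1, fderiv ℝ Φ M (β x)) 0 := by
      refine HasDerivAt.prodMk ?_ (HasDerivAt.prodMk ?_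
        (HasDerivAt.prodMk (hasDerivAt_pi.2 fun i => ?_) ?_))
      · simpa using ((hasDerivAt_id (0 : ℝ)).mul_const (φ x * e.2.1)).const_add ρ
      · simpa using ((hasDerivAt_id (0 : ℝ)).mul_const (φ x * e.2.2)).const_add s
      · simpa using ((hasDerivAt_id (0 : ℝ)).mul_const (φ x * e.1 i)).const_add
          (u i + ∑ j, A i j * x j)
      · have hΦd : HasFDerivAt Φ (fderiv ℝ Φ M) M :=
          (hΦ.differentiable (by simp) M).hasFDerivAt
        refine HasFDerivAt.comp_hasDerivAt_of_eq (0 : ℝ) hΦd ?_ (by simp)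
        simpa using ((hasDerivAt_id (0 : ℝ)).smul_const (β x)).const_add M
    have hFd : HasFDerivAt F (fderiv ℝ F (ρ, s, fun i => u i + ∑ j, A i j * x j, Φ M))
        (ρ, s, fun i => u i + ∑ j, A i j * x j, Φ M) :=
      ((hF.contDiffAt (isOpen_pos_fst.mem_nhds hρ)).differentiableAt (by simp)).hasFDerivAt
    exact (HasFDerivAt.comp_hasDerivAt_of_eq (0 : ℝ) hFd hc (by simp [c])).deriv.symm
  · exact ContDiffOn.of_le (hF.comp hcs.contDiffOn fun q hq => hpos q.1 hq.1 q.2)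
      (by exact_mod_cast le_top)
  · intro ε x hx
    have hz : φ x = 0 := image_eq_zero_of_notMem_tsupport hx
    have hβz : β x = 0 := by
      have hev : φ =ᶠ[𝓝 x] fun _ => 0 := by
        filter_upwards [(isClosed_tsupport _).isOpen_compl.mem_nhds hx] with y hy
        exact image_eq_zero_of_notMem_tsupport hy
      funext i j
      simp [hβ, partialDeriv_congr hev, partialDeriv_const]
    simp [c, hz, hβz]
  · intro ε hε
    have h0 : (0 : ℝ) ∈ Set.Ioo (-δ) δ := ⟨by linarith, hδ0⟩
    simp_rw [← hTc ε hε, ← hTc 0 h0]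
    have hmem : ∀ ε ∈ Set.Ioo (-δ) δ, ∀ x,
        𝒜 (fun x => affineField ρ s u A x + (ε * φ x) • e) x := fun ε hε x =>
      hadm (fun x => ε * φ x) (contDiff_const.mul hφ)
        (fun x => by rw [mul_assoc]; exact hpos ε hε x) x
    refine integral_totalDiv_sub h𝒜 hΘ (hmem ε hε) (hmem 0 h0) ?_ 0
    refine HasCompactSupport.intro hφc fun x hx => ?_
    have hz : φ x = 0 := image_eq_zero_of_notMem_tsupport hx
    simp [hz]

/-! ### Homogeneous functions of one variable -/

/-- The derivative vanishes off the origin, and at the origin by continuity. -/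
theorem eq_of_mul_deriv_eq_zero {k : ℝ → ℝ} (hk : ContDiff ℝ ∞ k) (h : ∀ r, r * deriv k r = 0)
    (r r' : ℝ) : k r = k r' := by
  have hc : Continuous (deriv k) := hk.continuous_deriv (by exact_mod_cast le_top)
  have : deriv k = fun _ => 0 := by
    refine Continuous.ext_on (dense_compl_singleton (0 : ℝ)) hc continuous_const fun r hr => ?_
    exact (mul_eq_zero.1 (h r)).resolve_left hr
  exact is_const_of_deriv_eq_zero (hk.differentiable (by simp)) (fun x => congrFun this x) r r'

theorem deriv_mul_deriv_eq {k : ℝ → ℝ} (hk : ContDiff ℝ ∞ k) {c : ℝ}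
    (h : ∀ r, r * deriv k r = c * k r) (r : ℝ) :
    r * deriv (deriv k) r = (c - 1) * deriv k r := by
  have hd : HasDerivAt k (deriv k r) r := (hk.differentiable (by simp) r).hasDerivAt
  have hk' : ContDiff ℝ ∞ (deriv k) := hk.iterate_deriv 1
  have hd2 : HasDerivAt (deriv k) (deriv (deriv k) r) r :=
    (hk'.differentiable (by simp) r).hasDerivAt
  have h1 := (hasDerivAt_id r).mul hd2
  have h2 := hd.const_mul c
  have e : (id * deriv k) = fun r => c * k r := funext h
  rw [e] at h1
  have := h1.unique h2
  simp at this
  linarith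

/-- A smooth solution of Euler's relation is a multiple of $r^N$, which contradicts the opposite
parity unless it is zero. The induction passes to the derivative, which lowers the degree by one and
reverses the parity; in degree zero the function is both constant and odd. -/
theorem eq_zero_of_mul_deriv_eq {k : ℝ → ℝ} (hk : ContDiff ℝ ∞ k) (N : ℕ)
    (h : ∀ r, r * deriv k r = N * k r) (hpar : ∀ r, k (-r) = (-1) ^ (N + 1) * k r) (r : ℝ) :
    k r = 0 := by
  induction N generalizing k r with
  | zero =>
    have h1 := eq_of_mul_deriv_eq_zero hk (by simpa using h) (-r) r
    have h2 := hpar r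
    simp at h2
    linarith
  | succ N ih =>
    have hz : ∀ r, deriv k r = 0 := by
      refine ih (hk.iterate_deriv 1) (fun r => ?_) fun r => ?_
      · simpa using deriv_mul_deriv_eq hk h r
      · have h1 : deriv (fun r => k (-r)) r = -deriv k (-r) := deriv_comp_neg k r
        have h2 : (fun r => k (-r)) = fun r => (-1) ^ (N + 1 + 1) * k r := funext hpar
        have hd : HasDerivAt k (deriv k r) r := (hk.differentiable (by simp) r).hasDerivAt
        rw [h2, (hd.const_mul _).deriv] at h1
        rw [← neg_eq_iff_eq_neg.2 h1]
        ring
    have := h r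
    rw [hz, mul_zero] at this
    have hN : ((N + 1 : ℕ) : ℝ) ≠ 0 := by positivity
    exact (mul_eq_zero.1 this.symm).resolve_left hN

/-- The derivative is homogeneous of degree zero and smooth across the origin, hence constant.
Smoothness excludes solutions such as $|r|$. -/
theorem eq_mul_of_mul_deriv_eq {k : ℝ → ℝ} (hk : ContDiff ℝ ∞ k)
    (h : ∀ r, r * deriv k r = k r) (r : ℝ) : k r = k 1 * r := by
  have hc := eq_of_mul_deriv_eq_zero (k := deriv k) (hk.iterate_deriv 1)
    (fun r => by simpa using deriv_mul_deriv_eq hk (c := 1) (by simpa using h) r) r 1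
  rw [← h r, ← h 1, hc]
  ring

/-! ### Densities of vorticity form that are total divergences -/

section
variable {Θ : ℝ → Fields n → Space n → Space n} {Z : Type*} [NormedAddCommGroup Z]
  [NormedSpace ℝ Z] {Φ : (Fin n → Fin n → ℝ) → Z} {F : ℝ × ℝ × Space n × Z → ℝ}

theorem hasFDerivAt_of_contDiffOn_pos (hF : ContDiffOn ℝ ∞ F {q | 0 < q.1})
    {p : ℝ × ℝ × Space n × Z} (hp : 0 < p.1) : HasFDerivAt F (fderiv ℝ F p) p :=
  ((hF.contDiffAt (isOpen_pos_fst.mem_nhds hp)).differentiableAt (by simp)).hasFDerivAt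

/-- Varying only density and entropy leaves the curl untouched, so the first variation involves
$\varphi$ but not its derivatives, and its coefficient must vanish pointwise. At $x=0$ the affine
velocity takes the value $u$. -/
theorem fderiv_eq_zero_of_variation {𝒜 : Fields n → Space n → Prop}
    (h𝒜 : ∀ U x, 𝒜 U x → IsRegularAt U x) (hΘ : IsLocalVector 𝒜 Θ) (hΦ : ContDiff ℝ ∞ Φ)
    (hF : ContDiffOn ℝ ∞ F {q | 0 < q.1})
    (hTF : ∀ t U x, 𝒜 U x →
      totalDiv Θ t U x = F (density U x, entropy U x, velocity U x, Φ (curl U x)))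
    {ρ : ℝ} (hρ : 0 < ρ) (s : ℝ) (u : Space n)
    {M : Fin n → Fin n → ℝ} (hM : ∀ i j, M j i = -M i j) (a b : ℝ)
    (hadm : ∀ φ : Space n → ℝ, ContDiff ℝ ∞ φ → (∀ x, 0 < ρ + φ x * a) →
      ∀ x, 𝒜 (fun x => affineField ρ s u M x + φ x • (0, a, b)) x) :
    fderiv ℝ F (ρ, s, u, Φ M) (a, b, 0, 0) = 0 := by
  have hcont : Continuous fun x : Space n =>
      fderiv ℝ F (ρ, s, fun i => u i + ∑ j, M i j * x j, Φ M) (a, b, 0, 0) := by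
    have h1 := hF.continuousOn_fderiv_of_isOpen isOpen_pos_fst (by simp)
    have h2 := h1.comp_continuous
      (f := fun x : Space n => ((ρ, s, fun i => u i + ∑ j, M i j * x j, Φ M) :
        ℝ × ℝ × Space n × Z)) (by fun_prop) (fun x => hρ)
    exact h2.clm_apply continuous_const
  have := eq_zero_of_forall_integral_mul_eq_zero hcont (fun φ hφ hφc => ?_) 0
  · simpa using this
  · rw [← integral_variation_eq_zero h𝒜 hΘ hΦ hF hTF hρ s u M (M := M)
      (fun i j => by rw [hM i j]; ring) (0, a, b) hadm hφ hφc]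
    refine MeasureTheory.integral_congr_ae (Filter.Eventually.of_forall fun x => ?_)
    simp only
    rw [← smul_eq_mul, ← map_smul]
    congr 1
    have : (fun i j : Fin n => ((0 : Space n) i * partialDeriv j φ x -
        (0 : Space n) j * partialDeriv i φ x) / 2) = 0 := by
      funext i j
      simp
    rw [this]
    simp

theorem isRegularAt_affineField_add {ρ : ℝ} (s : ℝ) (u : Space n) (A : Fin n → Fin n → ℝ)
    (e : Phase n) {φ : Space n → ℝ} (hφ : ContDiff ℝ ∞ φ) (hpos : ∀ x, 0 < ρ + φ x * e.2.1)
    (x : Space n) : IsRegularAt (fun x => affineField ρ s u A x + φ x • e) x :=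
  ⟨Filter.Eventually.of_forall fun _ =>
    ((contDiff_affineField ρ s u A).add (hφ.smul contDiff_const)).contDiffAt, hpos x⟩

theorem isConstEntropyAt_affineField_add {ρ : ℝ} (s : ℝ) (u : Space n) (A : Fin n → Fin n → ℝ)
    (e : Phase n) (he : e.2.2 = 0) {φ : Space n → ℝ} (hφ : ContDiff ℝ ∞ φ)
    (hpos : ∀ x, 0 < ρ + φ x * e.2.1)
    (x : Space n) : IsConstEntropyAt s (fun x => affineField ρ s u A x + φ x • e) x :=
  ⟨isRegularAt_affineField_add s u A e hφ hpos x,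
    Filter.Eventually.of_forall fun x => by simp [entropy, affineField, he]⟩

variable {P : ℝ → ℝ → ℝ} {s : ℝ}

theorem fderiv_density_eq_zero (hΘ : IsLocalVector (IsConstEntropyAt s) Θ) (hΦ : ContDiff ℝ ∞ Φ)
    (hF : ContDiffOn ℝ ∞ F {q | 0 < q.1})
    (hTF : ∀ t U x, IsConstEntropyAt s U x →
      totalDiv Θ t U x = F (density U x, entropy U x, velocity U x, Φ (curl U x)))
    {ρ : ℝ} (hρ : 0 < ρ) (u : Space n) {M : Fin n → Fin n → ℝ} (hM : ∀ i j, M j i = -M i j) :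
    fderiv ℝ F (ρ, s, u, Φ M) (1, 0, 0, 0) = 0 :=
  fderiv_eq_zero_of_variation (fun _ _ h => h.1) hΘ hΦ hF hTF hρ s u hM 1 0
    fun _ hφ hpos x => isConstEntropyAt_affineField_add s u M (0, 1, 0) rfl hφ hpos x

/-- The density derivative in `flux_affineField` is zero because $T$ is a divergence; what is left
is Euler's relation of degree $n/(2m)$ when $m\ne0$. -/
theorem euler_homogeneity (hΘ : IsLocalVector (IsConstEntropyAt s) Θ) (hΦ : ContDiff ℝ ∞ Φ)
    (hflux : HasZeroMovingFlux P (IsConstEntropyAt s) (totalDiv Θ)) {m : ℕ}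
    (hΦm : ∀ (c : ℝ) M, Φ (c • M) = c ^ m • Φ M) (hF : ContDiffOn ℝ ∞ F {q | 0 < q.1})
    (hTF : ∀ t U x, IsConstEntropyAt s U x →
      totalDiv Θ t U x = F (density U x, entropy U x, velocity U x, Φ (curl U x)))
    {ρ : ℝ} (hρ : 0 < ρ) (u : Space n) {M : Fin n → Fin n → ℝ} (hM : ∀ i j, M j i = -M i j) :
    n * F (ρ, s, u, Φ M) = 2 * m * fderiv ℝ F (ρ, s, u, Φ M) (0, 0, 0, Φ M) := by
  rw [← flux_affineField hflux hΦm hF hTF hρ u hM,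
    fderiv_density_eq_zero hΘ hΦ hF hTF hρ u hM, mul_zero, sub_zero]

theorem contDiff_slice (hF : ContDiffOn ℝ ∞ F {q | 0 < q.1}) {ρ : ℝ} (hρ : 0 < ρ) (s : ℝ)
    (u : Space n) : ContDiff ℝ ∞ fun z => F (ρ, s, u, z) :=
  contDiffOn_univ.1 (hF.comp (s := Set.univ)
    (f := fun z => ((ρ, s, u, z) : ℝ × ℝ × Space n × Z)) (by fun_prop) fun _ _ => hρ)

/-- Euler's relation has the fractional degree $(2m+1)/(2m)$ for $m>0$. Along $r\mapsto r^{2m}v$ the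
degree becomes the odd integer $n$, while the curve is even in $r$, so `eq_zero_of_mul_deriv_eq`
applies. -/
theorem eq_zero_of_odd (hn : Odd n) (hΘ : IsLocalVector (IsConstEntropyAt s) Θ)
    (hflux : HasZeroMovingFlux P (IsConstEntropyAt s) (totalDiv Θ))
    {F : ℝ × ℝ × Space n × Space n → ℝ} (hF : ContDiffOn ℝ ∞ F {q | 0 < q.1})
    (hTF : ∀ t U x, IsConstEntropyAt s U x →
      totalDiv Θ t U x = F (density U x, entropy U x, velocity U x, vorticityVector U x))
    {ρ : ℝ} (hρ : 0 < ρ) (u : Space n) {M : Fin n → Fin n → ℝ} (hM : ∀ i j, M j i = -M i j) :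
    F (ρ, s, u, pfaffianVec M) = 0 := by
  set m := (n - 1) / 2 with hm
  have hnm : n = 2 * m + 1 := by
    obtain ⟨k, hk⟩ := hn
    omega
  set v := pfaffianVec M
  have hk : ContDiff ℝ ∞ fun r : ℝ => F (ρ, s, u, r ^ (2 * m) • v) :=
    (contDiff_slice hF hρ s u).comp (by fun_prop)
  have key := eq_zero_of_mul_deriv_eq hk n (fun r => ?_) (fun r => ?_) 1
  · simpa using key
  -- Scaling $M$ by $r^2$ realizes every point of the curve as the vorticity vector of an
  -- antisymmetric matrix, where Euler's relation is known.
  · have hp : pfaffianVec (r ^ 2 • M) = r ^ (2 * m) • v := by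
      rw [pfaffianVec_smul, ← pow_mul]
    have hu := euler_homogeneity hΘ contDiff_pfaffianVec hflux pfaffianVec_smul hF hTF hρ u
      (M := r ^ 2 • M) (fun i j => by simp [hM i j])
    rw [hp] at hu
    rw [hu]
    have hc : HasDerivAt (fun r : ℝ => ((ρ, s, u, r ^ (2 * m) • v) :
        ℝ × ℝ × Space n × Space n)) (0, 0, 0, (((2 * m : ℕ) : ℝ) * r ^ (2 * m - 1)) • v) r :=
      (hasDerivAt_const _ _).prodMk ((hasDerivAt_const _ _).prodMk ((hasDerivAt_const _ _).prodMk
        ((hasDerivAt_pow (2 * m) r).smul_const v)))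
    have hFp := hasFDerivAt_of_contDiffOn_pos hF (p := (ρ, s, u, r ^ (2 * m) • v)) hρ
    rw [show deriv (fun r => F (ρ, s, u, r ^ (2 * m) • v)) r = _ from
      (hFp.comp_hasDerivAt r hc).deriv, ← smul_eq_mul, ← map_smul,
      ← hm, ← smul_eq_mul (2 * (m : ℝ)), ← map_smul]
    congr 1
    simp only [Prod.smul_mk, smul_zero, smul_smul]
    congr 4
    -- For $m=0$ the exponent $2m-1$ is truncated, but its coefficient vanishes.
    rcases Nat.eq_zero_or_pos m with h0 | h0
    · simp [h0]
    · have : r ^ (2 * m) = r * r ^ (2 * m - 1) := by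
        rw [← pow_succ']
        congr 1
        omega
      rw [this]
      push_cast
      ring
  · have h1 : (-1 : ℝ) ^ (n + 1) = 1 := by rw [hnm]; exact Even.neg_one_pow ⟨m + 1, by ring⟩
    have h2 : (-r) ^ (2 * m) = r ^ (2 * m) := (even_two_mul m).neg_pow r
    rw [h1, h2, one_mul]

theorem exists_pfaffian_eq (hn : Even n) (h2 : 1 < n) (w : ℝ) :
    ∃ M : Fin n → Fin n → ℝ, (∀ i j, M j i = -M i j) ∧ pfaffian M = w :=
  ⟨blockForm hn (w / pfaffian (blockForm hn 1)), blockForm_antisymm hn _, by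
    rw [pfaffian_blockForm hn h2, div_mul_cancel₀ _ (pfaffian_blockForm_one_pos hn).ne']⟩

/-- Here $2m=n$, so Euler's relation has degree one in $\varpi$. Every real number is the Pfaffian
of an antisymmetric matrix, so the relation holds on the whole line and forces linearity. -/
theorem eq_mul_vorticityScalar (hn : Even n) (h2 : 1 < n)
    (hΘ : IsLocalVector (IsConstEntropyAt s) Θ)
    (hflux : HasZeroMovingFlux P (IsConstEntropyAt s) (totalDiv Θ))
    {F : ℝ × ℝ × Space n × ℝ → ℝ} (hF : ContDiffOn ℝ ∞ F {q | 0 < q.1})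
    (hTF : ∀ t U x, IsConstEntropyAt s U x →
      totalDiv Θ t U x = F (density U x, entropy U x, velocity U x, vorticityScalar U x))
    {ρ : ℝ} (hρ : 0 < ρ) (u : Space n) (w : ℝ) :
    F (ρ, s, u, w) = F (1, s, u, 1) * w := by
  have hlin : F (1, s, u, w) = F (1, s, u, 1) * w := by
    refine eq_mul_of_mul_deriv_eq (contDiff_slice hF one_pos s u) (fun r => ?_) w
    obtain ⟨M, hM, rfl⟩ := exists_pfaffian_eq hn h2 r
    have hu := euler_homogeneity hΘ contDiff_pfaffian hflux pfaffian_smul hF hTF one_pos u hM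
    have hc : HasDerivAt (fun r : ℝ => (((1 : ℝ), s, u, r) : ℝ × ℝ × Space n × ℝ))
        (0, 0, 0, 1) (pfaffian M) :=
      (hasDerivAt_const _ _).prodMk ((hasDerivAt_const _ _).prodMk ((hasDerivAt_const _ _).prodMk
        (hasDerivAt_id _)))
    have hFp := hasFDerivAt_of_contDiffOn_pos hF (p := (1, s, u, pfaffian M)) one_pos
    rw [show deriv (fun r => F (1, s, u, r)) (pfaffian M) = _ from
      (hFp.comp_hasDerivAt _ hc).deriv, ← smul_eq_mul, ← map_smul]
    have hnm : (2 * ((n / 2 : ℕ) : ℝ)) = n := by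
      exact_mod_cast Nat.two_mul_div_two_of_even hn
    rw [hnm] at hu
    have hn0 : (n : ℝ) ≠ 0 := by positivity
    rw [mul_left_cancel₀ hn0 hu]
    simp
  rw [← hlin]
  -- The substitution $\rho=e^\tau$ turns the half-line of densities into all of $\mathbb R$, where
  -- a vanishing derivative gives constancy.
  have hconst : ∀ τ : ℝ, F (Real.exp τ, s, u, w) = F (Real.exp 0, s, u, w) := by
    obtain ⟨M, hM, rfl⟩ := exists_pfaffian_eq hn h2 w
    have hd : ∀ τ : ℝ, HasDerivAt (fun τ => F (Real.exp τ, s, u, pfaffian M)) 0 τ := by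
      intro τ
      have hc : HasDerivAt (fun τ : ℝ => ((Real.exp τ, s, u, pfaffian M) : ℝ × ℝ × Space n × ℝ))
          (Real.exp τ, 0, 0, 0) τ :=
        (Real.hasDerivAt_exp τ).prodMk ((hasDerivAt_const _ _).prodMk
          ((hasDerivAt_const _ _).prodMk (hasDerivAt_const _ _)))
      have hFp := hasFDerivAt_of_contDiffOn_pos hF (p := (Real.exp τ, s, u, pfaffian M))
        (Real.exp_pos τ)
      refine (hFp.comp_hasDerivAt τ hc).congr_deriv ?_
      have h0 := fderiv_density_eq_zero hΘ contDiff_pfaffian hF hTF (Real.exp_pos τ) u hM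
      have e : ((Real.exp τ, 0, 0, 0) : ℝ × ℝ × Space n × ℝ) = Real.exp τ • (1, 0, 0, 0) := by simp
      rw [e, map_smul, h0, smul_zero]
    exact fun τ => is_const_of_deriv_eq_zero (fun τ => (hd τ).differentiableAt)
      (fun τ => (hd τ).deriv) τ 0
  have := hconst (Real.log ρ)
  rwa [Real.exp_log hρ, Real.exp_zero] at this

/-- The coefficients of `∂ⱼφ` in the first variation of the Pfaffian under `u ↦ u + φ e₀`. -/
def pfaffianVariation (h2 : 1 < n) (M : Fin n → Fin n → ℝ) : Space n := fun j =>
  fderiv ℝ pfaffian M fun i k =>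
    ((Pi.single ⟨0, by omega⟩ 1 : Space n) i * (Pi.single j 1 : Space n) k -
      (Pi.single ⟨0, by omega⟩ 1 : Space n) k * (Pi.single j 1 : Space n) i) / 2

/-- The variation matrix is half of the missing block $e_0\wedge e_1$, and restoring that block
makes the Pfaffian nonzero to first order. -/
theorem pfaffianVariation_blockForm_ne_zero (hn : Even n) (h2 : 1 < n) :
    pfaffianVariation h2 (blockForm hn 0) ⟨1, h2⟩ ≠ 0 := by
  have h := fderiv_pfaffian_blockForm hn h2
  have e : (fun i k => ((Pi.single ⟨0, by omega⟩ 1 : Space n) i *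
      (Pi.single ⟨1, h2⟩ 1 : Space n) k - (Pi.single ⟨0, by omega⟩ 1 : Space n) k *
        (Pi.single ⟨1, h2⟩ 1 : Space n) i) / 2) =
      (2⁻¹ : ℝ) • (blockForm hn 1 - blockForm hn 0) := by
    funext i k
    rw [Pi.smul_apply, Pi.smul_apply, blockForm_one_sub_blockForm_zero]
    simp only [Pi.single_apply, Fin.ext_iff, smul_eq_mul]
    ring
  rw [pfaffianVariation, e, map_smul, h, smul_eq_mul]
  exact mul_ne_zero (by norm_num) (pfaffian_blockForm_one_pos hn).ne'

/-- The background has curl `blockForm hn 0`, hence $\varpi=0$. In the first variation of $b(\mathbf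
u)\,\varpi$ the term containing $\nabla b$ then drops out, and only $b$ times the variation of
$\varpi$, a derivative of $\varphi$ in a fixed direction, remains. -/
theorem integral_mul_fderiv_eq_zero (hn : Even n) (h2 : 1 < n)
    (hΘ : IsLocalVector (IsConstEntropyAt s) Θ)
    {F : ℝ × ℝ × Space n × ℝ → ℝ} (hF : ContDiffOn ℝ ∞ F {q | 0 < q.1})
    (hTF : ∀ t U x, IsConstEntropyAt s U x →
      totalDiv Θ t U x = F (density U x, entropy U x, velocity U x, vorticityScalar U x))
    {b : Space n → ℝ} (hb : ContDiff ℝ ∞ b) (hFb : ∀ u w, F (1, s, u, w) = b u * w)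
    (u : Space n) {A : Fin n → Fin n → ℝ}
    (hA : ∀ i j, blockForm hn 0 i j = (A i j - A j i) / 2)
    {φ : Space n → ℝ} (hφ : ContDiff ℝ ∞ φ) (hφc : HasCompactSupport φ) :
    ∫ x, b (fun i => u i + ∑ j, A i j * x j) *
      fderiv ℝ φ x (pfaffianVariation h2 (blockForm hn 0)) = 0 := by
  refine Eq.trans ?_ (integral_variation_eq_zero (fun _ _ h => h.1) hΘ contDiff_pfaffian hF hTF
    one_pos s u A hA (Pi.single ⟨0, by omega⟩ 1, 0, 0)
    (fun ψ hψ hpos x => isConstEntropyAt_affineField_add s u A _ rfl hψ hpos x) hφ hφc)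
  refine MeasureTheory.integral_congr_ae (Filter.Eventually.of_forall fun x => ?_)
  have hpf : pfaffian (blockForm hn 0) = 0 := by rw [pfaffian_blockForm hn h2, zero_mul]
  simp only [hpf, mul_zero]
  set y : Space n := fun i => u i + ∑ j, A i j * x j
  -- The product rule for $b(\mathbf u)\,w$ at $w=0$.
  have hfd : ∀ (a : Space n) (c : ℝ), fderiv ℝ F (1, s, y, 0) (0, 0, a, c) = b y * c := by
    intro a c
    have hc : HasDerivAt (fun ε : ℝ => (((1 : ℝ), s, y + ε • a, ε * c) : ℝ × ℝ × Space n × ℝ))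
        (0, 0, a, c) 0 := by
      refine (hasDerivAt_const _ _).prodMk ((hasDerivAt_const _ _).prodMk (HasDerivAt.prodMk ?_ ?_))
      · simpa using ((hasDerivAt_id (0 : ℝ)).smul_const a).const_add y
      · simpa using (hasDerivAt_id (0 : ℝ)).mul_const c
    have hFp := hasFDerivAt_of_contDiffOn_pos hF (p := (1, s, y, 0)) one_pos
    have h1 := HasFDerivAt.comp_hasDerivAt_of_eq (0 : ℝ) hFp hc (by simp)
    have hbd : HasFDerivAt b (fderiv ℝ b y) y := (hb.differentiable (by simp) y).hasFDerivAt
    have hcu : HasDerivAt (fun ε : ℝ => y + ε • a) a 0 := by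
      simpa using ((hasDerivAt_id (0 : ℝ)).smul_const a).const_add y
    have h3 := HasFDerivAt.comp_hasDerivAt_of_eq (0 : ℝ) hbd hcu (by simp)
    have h4 : HasDerivAt (fun ε : ℝ => ε * c) c 0 := by
      simpa using (hasDerivAt_id (0 : ℝ)).mul_const c
    have h5 := h3.mul h4
    have e : (F ∘ fun ε : ℝ => (((1 : ℝ), s, y + ε • a, ε * c) : ℝ × ℝ × Space n × ℝ)) =
        (b ∘ fun ε : ℝ => y + ε • a) * fun ε : ℝ => ε * c := funext fun ε => hFb _ _
    rw [e] at h1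
    rw [h1.unique h5]
    simp
  rw [hfd]
  congr 1
  have hV : ∀ j, pfaffianVariation h2 (blockForm hn 0) j = fderiv ℝ pfaffian (blockForm hn 0)
    fun i k => ((Pi.single ⟨0, by omega⟩ 1 : Space n) i * (Pi.single j 1 : Space n) k -
      (Pi.single ⟨0, by omega⟩ 1 : Space n) k * (Pi.single j 1 : Space n) i) / 2 := fun _ => rfl
  set V := pfaffianVariation h2 (blockForm hn 0)
  have hVsum : V = ∑ j, V j • (Pi.single j 1 : Space n) := by
    funext i
    simp [Finset.sum_apply, Pi.single_apply]
  rw [hVsum, map_sum]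
  simp_rw [map_smul, smul_eq_mul, hV]
  have : ∀ j, fderiv ℝ φ x (Pi.single j 1) = partialDeriv j φ x := fun _ => rfl
  simp_rw [this, mul_comm _ (partialDeriv _ φ x), ← smul_eq_mul (partialDeriv _ φ x), ← map_smul,
    ← map_sum]
  congr 1
  funext i k
  simp only [Finset.sum_apply, Pi.smul_apply, smul_eq_mul, Pi.single_apply]
  simp only [mul_div_assoc', mul_sub, sub_div, Finset.sum_sub_distrib, ← Finset.sum_div]
  congr 2 <;> simp

/-- Integrating the preceding identity by parts gives $\nabla b\cdot AV=0$ for every $A$ with the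
prescribed antisymmetric part. The symmetric part of $A$ is free and $V\ne0$, so the vectors $AV$
leave no room for a nonzero gradient. -/
theorem exists_eq_const_mul_vorticityScalar (hn : Even n) (h2 : 1 < n)
    (hΘ : IsLocalVector (IsConstEntropyAt s) Θ)
    (hflux : HasZeroMovingFlux P (IsConstEntropyAt s) (totalDiv Θ))
    {F : ℝ × ℝ × Space n × ℝ → ℝ} (hF : ContDiffOn ℝ ∞ F {q | 0 < q.1})
    (hTF : ∀ t U x, IsConstEntropyAt s U x →
      totalDiv Θ t U x = F (density U x, entropy U x, velocity U x, vorticityScalar U x))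
    {ρ : ℝ} (hρ : 0 < ρ) (u : Space n) (w : ℝ) :
    F (ρ, s, u, w) = F (1, s, 0, 1) * w := by
  set b : Space n → ℝ := fun u => F (1, s, u, 1) with hbdef
  have hFb : ∀ {ρ : ℝ}, 0 < ρ → ∀ u w, F (ρ, s, u, w) = b u * w := fun hρ u w =>
    eq_mul_vorticityScalar hn h2 hΘ hflux hF hTF hρ u w
  have hb : ContDiff ℝ ∞ b :=
    contDiffOn_univ.1 (hF.comp (s := Set.univ)
      (f := fun u => (((1 : ℝ), s, u, (1 : ℝ)) : ℝ × ℝ × Space n × ℝ)) (by fun_prop)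
      fun _ _ => one_pos (α := ℝ))
  set V := pfaffianVariation h2 (blockForm hn 0) with hVdef
  -- The derivative of $x\mapsto b(u+Ax)$ along $V$ is orthogonal to all test functions; it is read
  -- off at $x=0$.
  have hstep : ∀ (u : Space n) (A : Fin n → Fin n → ℝ),
      (∀ i j, blockForm hn 0 i j = (A i j - A j i) / 2) →
      fderiv ℝ b u (fun i => ∑ j, A i j * V j) = 0 := by
    intro u A hA
    let y : Space n → Space n := fun x i => u i + ∑ j, A i j * x j
    have hy : ContDiff ℝ ∞ y := by
      simp only [y]
      fun_prop
    have hby : ContDiff ℝ ∞ fun x => b (y x) := hb.comp hy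
    have hcont : Continuous fun x => fderiv ℝ (fun x => b (y x)) x V :=
      (hby.continuous_fderiv (by simp)).clm_apply continuous_const
    have hz := eq_zero_of_forall_integral_mul_eq_zero hcont (fun φ hφ hφc => ?_) 0
    · have hyd : HasFDerivAt y (ContinuousLinearMap.pi fun i =>
          ∑ j, A i j • (ContinuousLinearMap.proj j : Space n →L[ℝ] ℝ)) 0 :=
        hasFDerivAt_pi.2 fun i => HasFDerivAt.const_add _ (HasFDerivAt.fun_sum fun j _ =>
          (hasFDerivAt_apply j (0 : Space n)).const_mul (A i j))
      have hy0 : y 0 = u := by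
        funext i
        simp [y]
      have hbd : HasFDerivAt b (fderiv ℝ b u) (y 0) := by
        rw [hy0]
        exact (hb.differentiable (by simp) u).hasFDerivAt
      rw [show fderiv ℝ (fun x => b (y x)) 0 = _ from (hbd.comp (0 : Space n) hyd).fderiv] at hz
      rw [← hz, ContinuousLinearMap.comp_apply]
      congr 1
      funext i
      simp
    · have h0 := integral_mul_fderiv_eq_zero hn h2 hΘ hF hTF hb (hFb one_pos) u hA hφ hφc
      have hφd : Continuous fun x => fderiv ℝ φ x V :=
        (hφ.continuous_fderiv (by simp)).clm_apply continuous_const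
      have hibp := integral_mul_fderiv_eq_neg_fderiv_mul_of_integrable
        (μ := MeasureTheory.volume) (f := fun x => b (y x)) (g := φ) (v := V)
        ((hcont.mul hφ.continuous).integrable_of_hasCompactSupport hφc.mul_left)
        ((hby.continuous.mul hφd).integrable_of_hasCompactSupport (hφc.fderiv_apply ℝ V).mul_left)
        ((hby.continuous.mul hφ.continuous).integrable_of_hasCompactSupport hφc.mul_left)
        (fun x _ => hby.differentiable (by simp) x) (fun x _ => hφ.differentiable (by simp) x)
      rw [show ∫ x, b (y x) * fderiv ℝ φ x V = 0 from h0] at hibp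
      simp_rw [mul_comm (φ _)]
      linarith
  -- Two choices of $A$ with the same antisymmetric part differ by an arbitrary symmetric matrix.
  have hsym : ∀ (u : Space n) (S : Fin n → Fin n → ℝ), (∀ i j, S i j = S j i) →
      fderiv ℝ b u (fun i => ∑ j, S i j * V j) = 0 := by
    intro u S hS
    have h0 := hstep u (blockForm hn 0) fun i j => by rw [blockForm_antisymm hn 0 i j]; ring
    have h1 := hstep u (blockForm hn 0 + S) fun i j => by
      simp only [Pi.add_apply]
      rw [blockForm_antisymm hn 0 i j, hS i j]
      ring
    have e : (fun i => ∑ j, (blockForm hn 0 + S) i j * V j) =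
        (fun i => ∑ j, blockForm hn 0 i j * V j) + fun i => ∑ j, S i j * V j := by
      funext i
      simp [add_mul, Finset.sum_add_distrib]
    rw [e, map_add, h0, zero_add] at h1
    exact h1
  have hV1 : V ⟨1, h2⟩ ≠ 0 := pfaffianVariation_blockForm_ne_zero hn h2
  -- The matrices $e_1\otimes e_1$ and $e_k\otimes e_1+e_1\otimes e_k$ send $V$ to $V_1e_1$ and
  -- $V_1e_k+V_ke_1$; since $V_1\ne0$, these span.
  have hfd : ∀ u, fderiv ℝ b u = 0 := by
    intro u
    set o : Fin n := ⟨1, h2⟩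
    have h1 : fderiv ℝ b u (Pi.single o 1) = 0 := by
      have h := hsym u (fun i j => (Pi.single o 1 : Space n) i * (Pi.single o 1 : Space n) j)
        fun i j => mul_comm _ _
      have e : (fun i => ∑ j, (Pi.single o 1 : Space n) i * (Pi.single o 1 : Space n) j * V j) =
          V o • (Pi.single o 1 : Space n) := by
        funext i
        simp [Pi.single_apply]
      rw [e, map_smul] at h
      exact (smul_eq_zero.1 h).resolve_left hV1
    have hk : ∀ k, fderiv ℝ b u (Pi.single k 1) = 0 := by
      intro k
      have h := hsym u (fun i j => (Pi.single k 1 : Space n) i * (Pi.single o 1 : Space n) j +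
        (Pi.single o 1 : Space n) i * (Pi.single k 1 : Space n) j) fun i j => by ring
      have e : (fun i => ∑ j, ((Pi.single k 1 : Space n) i * (Pi.single o 1 : Space n) j +
          (Pi.single o 1 : Space n) i * (Pi.single k 1 : Space n) j) * V j) =
          V o • (Pi.single k 1 : Space n) + V k • (Pi.single o 1 : Space n) := by
        funext i
        simp [add_mul, Finset.sum_add_distrib, Pi.single_apply]
      rw [e, map_add, map_smul, map_smul, h1, smul_zero, add_zero] at h
      exact (smul_eq_zero.1 h).resolve_left hV1
    refine ContinuousLinearMap.ext fun v => ?_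
    have hv : v = ∑ k, v k • (Pi.single k 1 : Space n) := by
      funext i
      simp [Finset.sum_apply, Pi.single_apply]
    rw [hv, map_sum]
    simp [hk]
  rw [hFb hρ u w, is_const_of_fderiv_eq_zero (𝕜 := ℝ) (hb.differentiable (by simp)) hfd u 0]

end

/-! ### The generalized circulation -/

theorem IsRegularAt.contDiffAt {U : Fields n} {x : Space n} (h : IsRegularAt U x) :
    ContDiffAt ℝ ∞ U x := h.1.self_of_nhds

theorem IsRegularAt.velocity {U : Fields n} {x : Space n} (h : IsRegularAt U x) (i : Fin n) :
    ContDiffAt ℝ ∞ (fun y => Fluid.velocity U y i) x :=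
  contDiffAt_pi.1 (contDiffAt_fst.comp x h.contDiffAt) i

theorem IsRegularAt.density {U : Fields n} {x : Space n} (h : IsRegularAt U x) :
    ContDiffAt ℝ ∞ (Fluid.density U) x :=
  (contDiffAt_fst.comp (U x) contDiffAt_snd).comp x h.contDiffAt

theorem IsRegularAt.entropy {U : Fields n} {x : Space n} (h : IsRegularAt U x) :
    ContDiffAt ℝ ∞ (Fluid.entropy U) x :=
  (contDiffAt_snd.comp (U x) contDiffAt_snd).comp x h.contDiffAt

theorem IsRegularAt.curl {U : Fields n} {x : Space n} (h : IsRegularAt U x) (i j : Fin n) :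
    ContDiffAt ℝ ∞ (fun y => Fluid.curl U y i j) x :=
  (((h.velocity i).partialDeriv j).sub ((h.velocity j).partialDeriv i)).div_const 2

theorem IsRegularAt.eventually {U : Fields n} {x : Space n} (h : IsRegularAt U x) :
    ∀ᶠ y in 𝓝 x, IsRegularAt U y := by
  filter_upwards [h.1.eventually_nhds, h.density.continuousAt.eventually (lt_mem_nhds h.2)]
    with y h1 h2 using ⟨h1, h2⟩

/-- Contraction of the orientation tensor with something symmetric in two slots: composing with the
transposition changes the sign of the sum. -/
theorem sum_sign_mul_eq_zero {f : Equiv.Perm (Fin n) → ℝ} {p q : Fin n} (hpq : p ≠ q)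
    (hf : ∀ σ, f (σ * Equiv.swap p q) = f σ) :
    ∑ σ : Equiv.Perm (Fin n), ((Equiv.Perm.sign σ : ℤ) : ℝ) * f σ = 0 := by
  have h := Equiv.sum_comp (Equiv.mulRight (Equiv.swap p q))
    (fun σ : Equiv.Perm (Fin n) => ((Equiv.Perm.sign σ : ℤ) : ℝ) * f σ)
  simp only [Equiv.coe_mulRight, hf, Equiv.Perm.sign_mul, Equiv.Perm.sign_swap hpq] at h
  simp only [mul_neg, mul_one, Units.val_neg, Int.cast_neg, neg_mul, Finset.sum_neg_distrib] at h
  linarith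

theorem prod_fin_eq_mul_prod {N m : ℕ} (h : N = m + 1) (g : Fin N → ℝ) :
    ∏ k, g k = g ⟨0, by omega⟩ * ∏ k : Fin m, g ⟨k.1 + 1, by omega⟩ := by
  subst h
  exact Fin.prod_univ_succ g

theorem partialDeriv_prod {ι : Type*} [DecidableEq ι] {s : Finset ι} {f : ι → Space n → ℝ}
    {x : Space n} (hf : ∀ k ∈ s, DifferentiableAt ℝ (f k) x) (i : Fin n) :
    partialDeriv i (fun y => ∏ k ∈ s, f k y) x =
      ∑ k ∈ s, partialDeriv i (f k) x * ∏ l ∈ s.erase k, f l x := by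
  rw [HasFDerivAt.partialDeriv_eq (HasFDerivAt.finsetProd fun k hk => (hf k hk).hasFDerivAt)]
  simp [partialDeriv, mul_comm]

theorem partialDeriv_curl {U : Fields n} {x : Space n} (hU : IsRegularAt U x) (c a b : Fin n) :
    partialDeriv c (fun y => curl U y a b) x =
      (partialDeriv c (partialDeriv b fun y => velocity U y a) x -
        partialDeriv c (partialDeriv a fun y => velocity U y b) x) / 2 := by
  have h1 := ((hU.velocity a).partialDeriv b).differentiableAt (by simp)
  have h3 := ((hU.velocity b).partialDeriv a).differentiableAt (by simp)
  rw [← partialDeriv_sub h1 h3, div_eq_inv_mul, ← partialDeriv_const_mul (h1.fun_sub h3)]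
  refine partialDeriv_congr (Filter.Eventually.of_forall fun y => ?_) c
  simp only [curl]
  ring

/-- The first index `2k + 2` of the `k`-th pair of the vorticity tensor. -/
def tensorFst (k : Fin ((n - 2) / 2)) : Fin n := ⟨2 * k.1 + 2, by have := k.2; omega⟩

/-- The second index `2k + 3` of the `k`-th pair of the vorticity tensor. -/
def tensorSnd (k : Fin ((n - 2) / 2)) : Fin n := ⟨2 * k.1 + 3, by have := k.2; omega⟩

/-- Absorbing the index $j$ into the permutation leaves a single sum, on which antisymmetry
arguments can act by transpositions. -/
theorem circulation_apply (h2 : 1 < n) (t : ℝ) (U : Fields n) (x : Space n) (i : Fin n) :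
    circulation t U x i = ∑ σ : Equiv.Perm (Fin n), if σ ⟨0, by omega⟩ = i then
      ((Equiv.Perm.sign σ : ℤ) : ℝ) *
        ((∏ k, curl U x (σ (tensorFst k)) (σ (tensorSnd k))) * velocity U x (σ ⟨1, h2⟩))
      else 0 := by
  have hc : ∀ (σ : Equiv.Perm (Fin n)) (a b : Fin n), (σ.symm a).1 = b.1 ↔ σ b = a := by
    intro σ a b
    rw [← Fin.ext_iff, Equiv.symm_apply_eq, eq_comm]
  simp only [circulation, vorticityTensor, Finset.sum_filter, Finset.sum_mul]
  rw [Finset.sum_comm]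
  refine Finset.sum_congr rfl fun σ _ => ?_
  have e0 : (σ.symm i).1 = 0 ↔ σ ⟨0, by omega⟩ = i := hc σ i ⟨0, by omega⟩
  have e1 : ∀ j, (σ.symm j).1 = 1 ↔ σ ⟨1, h2⟩ = j := fun j => hc σ j ⟨1, h2⟩
  simp only [e0, e1]
  by_cases hi : σ ⟨0, by omega⟩ = i
  · simp only [hi, true_and, if_true, ite_mul, zero_mul, Finset.sum_ite_eq, Finset.mem_univ,
      mul_assoc]
    rfl
  · simp [hi]

theorem pfaffian_eq_tensor (h2 : 1 < n) (M : Fin n → Fin n → ℝ) :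
    pfaffian M = ∑ σ : Equiv.Perm (Fin n), ((Equiv.Perm.sign σ : ℤ) : ℝ) *
      (M (σ ⟨0, by omega⟩) (σ ⟨1, h2⟩) * ∏ k, M (σ (tensorFst k)) (σ (tensorSnd k))) := by
  have h : n / 2 = (n - 2) / 2 + 1 := by omega
  refine Finset.sum_congr rfl fun σ _ => ?_
  rw [prod_fin_eq_mul_prod h]
  rfl

/-- The divergence of the generalized circulation is the vorticity scalar, up to sign. -/
theorem totalDiv_circulation (h2 : 1 < n) (t : ℝ) {U : Fields n} {x : Space n}
    (hU : IsRegularAt U x) : totalDiv circulation t U x = -vorticityScalar U x := by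
  have hdc : ∀ a b, DifferentiableAt ℝ (fun y => curl U y a b) x := fun a b =>
    (hU.curl a b).differentiableAt (by simp)
  have hdv : ∀ a, DifferentiableAt ℝ (fun y => velocity U y a) x := fun a =>
    (hU.velocity a).differentiableAt (by simp)
  have hdp : ∀ σ : Equiv.Perm (Fin n), DifferentiableAt ℝ
      (fun y => ∏ k, curl U y (σ (tensorFst k)) (σ (tensorSnd k))) x := fun σ =>
    (HasFDerivAt.finsetProd fun k _ => (hdc _ _).hasFDerivAt).differentiableAt
  set o : Fin n := ⟨0, by omega⟩ with ho
  have hdiv : totalDiv circulation t U x = ∑ σ : Equiv.Perm (Fin n),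
      ((Equiv.Perm.sign σ : ℤ) : ℝ) * partialDeriv (σ o) (fun y =>
        (∏ k, curl U y (σ (tensorFst k)) (σ (tensorSnd k))) * velocity U y (σ ⟨1, h2⟩)) x := by
    simp only [totalDiv, divergence, circulation_apply h2]
    have : ∀ i, partialDeriv i (fun y => ∑ σ : Equiv.Perm (Fin n), if σ o = i then
        ((Equiv.Perm.sign σ : ℤ) : ℝ) * ((∏ k, curl U y (σ (tensorFst k)) (σ (tensorSnd k))) *
          velocity U y (σ ⟨1, h2⟩)) else 0) x = ∑ σ : Equiv.Perm (Fin n), if σ o = i then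
        ((Equiv.Perm.sign σ : ℤ) : ℝ) * partialDeriv (σ o) (fun y =>
          (∏ k, curl U y (σ (tensorFst k)) (σ (tensorSnd k))) * velocity U y (σ ⟨1, h2⟩)) x
        else 0 := by
      intro i
      rw [partialDeriv_sum]
      · refine Finset.sum_congr rfl fun σ _ => ?_
        by_cases hi : σ o = i
        · simp only [hi, if_true]
          exact partialDeriv_const_mul ((hdp σ).mul (hdv _)) _ i
        · simp only [hi, if_false]
          exact partialDeriv_const 0 x i
      · intro σ _
        by_cases hi : σ o = i
        · simp only [hi, if_true]
          exact ((hdp σ).mul (hdv _)).const_mul _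
        · simp only [hi, if_false]
          exact differentiableAt_const _
    rw [Finset.sum_congr rfl fun i _ => this i, Finset.sum_comm]
    simp
  have hne01 : o ≠ ⟨1, h2⟩ := by simp [ho]
  have hprod : ∀ (σ : Equiv.Perm (Fin n)), partialDeriv (σ o) (fun y =>
      (∏ k, curl U y (σ (tensorFst k)) (σ (tensorSnd k))) * velocity U y (σ ⟨1, h2⟩)) x =
      (∏ k, curl U x (σ (tensorFst k)) (σ (tensorSnd k))) *
        partialDeriv (σ o) (fun y => velocity U y (σ ⟨1, h2⟩)) x +
      ∑ k, partialDeriv (σ o) (fun y => curl U y (σ (tensorFst k)) (σ (tensorSnd k))) x *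
        (∏ l ∈ Finset.univ.erase k, curl U x (σ (tensorFst l)) (σ (tensorSnd l))) *
        velocity U x (σ ⟨1, h2⟩) := by
    intro σ
    rw [partialDeriv_mul (hdp σ) (hdv _), partialDeriv_prod (fun k _ => hdc _ _), Finset.sum_mul]
  -- This is $d\omega=0$: when the derivative falls on a factor $\omega$, each of its two second
  -- derivatives of $\mathbf u$ is symmetric in the slot of the derivative and one slot of that
  -- factor.
  have hzero : ∀ k : Fin ((n - 2) / 2), ∑ σ : Equiv.Perm (Fin n),
      ((Equiv.Perm.sign σ : ℤ) : ℝ) *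
        (partialDeriv (σ o) (fun y => curl U y (σ (tensorFst k)) (σ (tensorSnd k))) x *
        (∏ l ∈ Finset.univ.erase k, curl U x (σ (tensorFst l)) (σ (tensorSnd l))) *
        velocity U x (σ ⟨1, h2⟩)) = 0 := by
    intro k
    have hswap : ∀ (q : Fin n), (q = tensorFst k ∨ q = tensorSnd k) →
        ∀ σ : Equiv.Perm (Fin n),
        (∏ l ∈ Finset.univ.erase k, curl U x ((σ * Equiv.swap o q) (tensorFst l))
            ((σ * Equiv.swap o q) (tensorSnd l))) * velocity U x ((σ * Equiv.swap o q) ⟨1, h2⟩) =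
          (∏ l ∈ Finset.univ.erase k, curl U x (σ (tensorFst l)) (σ (tensorSnd l))) *
            velocity U x (σ ⟨1, h2⟩) := by
      intro q hq σ
      have h1 : Equiv.swap o q ⟨1, h2⟩ = ⟨1, h2⟩ := by
        refine Equiv.swap_apply_of_ne_of_ne hne01.symm ?_
        rcases hq with rfl | rfl <;> simp [tensorFst, tensorSnd]
      rw [Equiv.Perm.mul_apply, h1]
      congr 1
      refine Finset.prod_congr rfl fun l hl => ?_
      have hl' : l.1 ≠ k.1 := fun h => Finset.ne_of_mem_erase hl (Fin.ext h)
      rw [Equiv.Perm.mul_apply, Equiv.Perm.mul_apply, Equiv.swap_apply_of_ne_of_ne,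
        Equiv.swap_apply_of_ne_of_ne]
      · simp [tensorSnd, ho]
      · rcases hq with rfl | rfl <;> simp only [tensorFst, tensorSnd, ne_eq, Fin.ext_iff] <;> omega
      · simp [tensorFst, ho]
      · rcases hq with rfl | rfl <;> simp only [tensorFst, tensorSnd, ne_eq, Fin.ext_iff] <;> omega
    have hof : o ≠ tensorFst k := by simp [ho, tensorFst]
    have hos : o ≠ tensorSnd k := by simp [ho, tensorSnd]
    have hfs : tensorFst k ≠ tensorSnd k := by simp [tensorFst, tensorSnd]
    have z1 := sum_sign_mul_eq_zero (f := fun σ : Equiv.Perm (Fin n) =>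
      partialDeriv (σ o) (partialDeriv (σ (tensorSnd k))
        fun y => velocity U y (σ (tensorFst k))) x *
      ((∏ l ∈ Finset.univ.erase k, curl U x (σ (tensorFst l)) (σ (tensorSnd l))) *
        velocity U x (σ ⟨1, h2⟩))) hos fun σ => by
      rw [hswap _ (Or.inr rfl), partialDeriv_comm (hU.velocity _)]
      simp only [Equiv.Perm.mul_apply, Equiv.swap_apply_left, Equiv.swap_apply_right,
        Equiv.swap_apply_of_ne_of_ne hof.symm hfs]
    have z2 := sum_sign_mul_eq_zero (f := fun σ : Equiv.Perm (Fin n) =>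
      partialDeriv (σ o) (partialDeriv (σ (tensorFst k))
        fun y => velocity U y (σ (tensorSnd k))) x *
      ((∏ l ∈ Finset.univ.erase k, curl U x (σ (tensorFst l)) (σ (tensorSnd l))) *
        velocity U x (σ ⟨1, h2⟩))) hof fun σ => by
      rw [hswap _ (Or.inl rfl), partialDeriv_comm (hU.velocity _)]
      simp only [Equiv.Perm.mul_apply, Equiv.swap_apply_left, Equiv.swap_apply_right,
        Equiv.swap_apply_of_ne_of_ne hos.symm hfs.symm]
    rw [← mul_zero (2⁻¹ : ℝ), ← sub_zero (0 : ℝ)]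
    nth_rewrite 1 [← z1]
    rw [← z2, ← Finset.sum_sub_distrib, Finset.mul_sum]
    refine Finset.sum_congr rfl fun σ _ => ?_
    rw [partialDeriv_curl hU]
    ring
  rw [hdiv, vorticityScalar_eq, pfaffian_eq_tensor h2]
  simp_rw [hprod, mul_add, Finset.mul_sum]
  rw [Finset.sum_add_distrib, Finset.sum_comm (s := Finset.univ (α := Equiv.Perm (Fin n)))
    (t := Finset.univ (α := Fin ((n - 2) / 2))), Finset.sum_eq_zero fun k _ => hzero k, add_zero,
    ← Finset.sum_neg_distrib, ← sub_eq_zero, ← Finset.sum_sub_distrib]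
  -- The convention $\omega^{ij}=\tfrac12(\partial_ju^i-\partial_iu^j)$ gives
  -- $\partial_iu^j+\omega^{ij}=\tfrac12(\partial_iu^j+\partial_ju^i)$, which is symmetric and
  -- disappears. This is the source of the minus sign.
  have z := sum_sign_mul_eq_zero (f := fun σ : Equiv.Perm (Fin n) =>
    (∏ k, curl U x (σ (tensorFst k)) (σ (tensorSnd k))) *
      (partialDeriv (σ o) (fun y => velocity U y (σ ⟨1, h2⟩)) x +
        partialDeriv (σ ⟨1, h2⟩) (fun y => velocity U y (σ o)) x)) hne01 fun σ => by
    have hsw : ∀ k, Equiv.swap o ⟨1, h2⟩ (tensorFst k) = tensorFst k ∧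
        Equiv.swap o ⟨1, h2⟩ (tensorSnd k) = tensorSnd k := fun k =>
      ⟨Equiv.swap_apply_of_ne_of_ne (by simp [tensorFst, ho]) (by simp [tensorFst]),
        Equiv.swap_apply_of_ne_of_ne (by simp [tensorSnd, ho]) (by simp [tensorSnd])⟩
    simp only [Equiv.Perm.mul_apply, Equiv.swap_apply_left, Equiv.swap_apply_right, hsw]
    ring
  rw [← mul_zero (2⁻¹ : ℝ), ← z, Finset.mul_sum]
  refine Finset.sum_congr rfl fun σ _ => ?_
  rw [show curl U x (σ o) (σ ⟨1, h2⟩) = _ from rfl, curl]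
  ring

theorem isLocalVector_circulation {𝒜 : Fields n → Space n → Prop}
    (h𝒜 : ∀ U x, 𝒜 U x → IsRegularAt U x) : IsLocalVector 𝒜 (circulation (n := n)) := by
  -- The curl read off from the first derivatives of the fields, so order $1$ suffices.
  let c : Derivs n 1 → Fin n → Fin n → ℝ := fun D i j =>
    ((D 0 fun _ => Pi.single j 1).1 i - (D 0 fun _ => Pi.single i 1).1 j) / 2
  have hc : ∀ i j, ContDiff ℝ ∞ fun D => c D i j := by
    have h1 : ∀ i j : Fin n, ContDiff ℝ ∞ fun D : Derivs n 1 =>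
        (D 0 fun _ => (Pi.single j 1 : Space n)).1 i := by
      intro i j
      have h2 : ContDiff ℝ ∞ fun D : Derivs n 1 => D 0 fun _ => (Pi.single j 1 : Space n) :=
        (ContinuousMultilinearMap.apply ℝ (fun _ : Fin 1 => Space n) (Phase n)
          fun _ => (Pi.single j 1 : Space n)).contDiff.comp 
          (ContinuousLinearMap.proj (R := ℝ)
            (φ := fun j : Fin 1 => Space n [×(j.1 + 1)]→L[ℝ] Phase n) 0).contDiff
      exact contDiff_pi.1 (contDiff_fst.comp h2) i
    exact fun i j => ((h1 i j).sub (h1 j i)).div_const 2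
  refine ⟨1, fun q i => ∑ j, (∑ σ : Equiv.Perm (Fin n) with (σ.symm i).1 = 0 ∧ (σ.symm j).1 = 1,
    ((Equiv.Perm.sign σ : ℤ) : ℝ) * ∏ k, c q.2.2.2 (σ (tensorFst k)) (σ (tensorSnd k))) *
      q.2.2.1.1 j, ContDiff.contDiffOn ?_, fun t U x hU => ?_⟩
  · refine contDiff_pi.2 fun i => ContDiff.sum fun j _ => ContDiff.mul (ContDiff.sum fun σ _ =>
      contDiff_const.mul (contDiff_prod fun k _ => ?_)) (by fun_prop)
    exact (hc _ _).comp (by fun_prop)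
  · have hd : DifferentiableAt ℝ U x := (h𝒜 U x hU).contDiffAt.differentiableAt (by simp)
    have hcurl : c (fun j => iteratedFDeriv ℝ (j.1 + 1) U x) = curl U x := by
      have h1 : ∀ i j : Fin n, (iteratedFDeriv ℝ 1 U x fun _ => Pi.single j 1).1 i =
          partialDeriv j (fun y => velocity U y i) x := by
        intro i j
        have h2 : HasFDerivAt (fun y => velocity U y i) _ x :=
          hasFDerivAt_pi'.1 (hd.hasFDerivAt.fst) i
        rw [HasFDerivAt.partialDeriv_eq h2, iteratedFDeriv_one_apply]
        rfl
      funext i j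
      exact congrArg (· / 2) (congrArg₂ (· - ·) (h1 i j) (h1 j i))
    funext i
    simp only [hcurl]
    rfl

variable {P : ℝ → ℝ → ℝ}

/-! ### The transport of the vorticity scalar -/

/-- The pressure field. -/
def pressure (P : ℝ → ℝ → ℝ) (U : Fields n) (x : Space n) : ℝ := P (density U x) (entropy U x)

theorem IsRegularAt.pressure (hP : IsEquationOfState P) {U : Fields n} {x : Space n}
    (h : IsRegularAt U x) : ContDiffAt ℝ ∞ (Fluid.pressure P U) x := by
  have h1 : ContDiffAt ℝ ∞ (fun q : ℝ × ℝ => P q.1 q.2) (Fluid.density U x, Fluid.entropy U x) :=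
    hP.contDiffAt (isOpen_pos_fst.mem_nhds h.2)
  exact h1.comp x (h.density.prodMk h.entropy)

/-- The force per unit mass `ρ⁻¹∇p`. -/
def force (P : ℝ → ℝ → ℝ) (U : Fields n) (i : Fin n) (x : Space n) : ℝ :=
  (density U x)⁻¹ * partialDeriv i (pressure P U) x

theorem IsRegularAt.force (hP : IsEquationOfState P) {U : Fields n} {x : Space n}
    (h : IsRegularAt U x) (i : Fin n) : ContDiffAt ℝ ∞ (Fluid.force P U i) x :=
  (h.density.inv h.2.ne').mul ((h.pressure hP).partialDeriv i)

theorem velocity_eulerRHS (U : Fields n) (x : Space n) (i : Fin n) :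
    velocity (eulerRHS P U) x i =
      -(∑ j, velocity U x j * partialDeriv j (fun y => velocity U y i) x) - force P U i x := rfl

theorem IsRegularAt.eulerRHS (hP : IsEquationOfState P) {U : Fields n} {x : Space n}
    (h : IsRegularAt U x) : ContDiffAt ℝ ∞ (Fluid.eulerRHS P U) x := by
  refine ContDiffAt.prodMk (contDiffAt_pi.2 fun i => ?_) (ContDiffAt.prodMk ?_ ?_)
  · exact (ContDiffAt.sum fun j _ => (h.velocity j).mul ((h.velocity i).partialDeriv j)).neg.sub
      (h.force hP i)
  · exact (ContDiffAt.sum fun i _ => (h.density.mul (h.velocity i)).partialDeriv i).neg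
  · exact (ContDiffAt.sum fun j _ => (h.velocity j).mul (h.entropy.partialDeriv j)).neg

/-- The formula for $T$ is known only on regular fields; this allows its use along the curve that
defines `evolDeriv`. -/
theorem IsRegularAt.add_smul_eulerRHS (hP : IsEquationOfState P) {U : Fields n} {x : Space n}
    (h : IsRegularAt U x) :
    ∀ᶠ ε : ℝ in 𝓝 0, IsRegularAt (U + ε • Fluid.eulerRHS P U) x := by
  have hc : Continuous fun ε : ℝ => Fluid.density U x + ε * (Fluid.eulerRHS P U x).2.1 := by
    fun_prop
  have hpos := hc.continuousAt.eventually
    (lt_mem_nhds (a := 0) (b := Fluid.density U x + 0 * (Fluid.eulerRHS P U x).2.1)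
      (by simpa using h.2))
  filter_upwards [hpos] with ε hε
  refine ⟨?_, hε⟩
  filter_upwards [h.eventually] with y hy
  exact hy.contDiffAt.add (contDiffAt_const.smul (hy.eulerRHS hP))

theorem curl_add_smul {U V : Fields n} {x : Space n}
    (hU : ∀ i, DifferentiableAt ℝ (fun y => velocity U y i) x)
    (hV : ∀ i, DifferentiableAt ℝ (fun y => velocity V y i) x) (ε : ℝ) :
    curl (U + ε • V) x = curl U x + ε • curl V x := by
  have h : ∀ i j, partialDeriv j (fun y => velocity (U + ε • V) y i) x =
      partialDeriv j (fun y => velocity U y i) x +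
        ε * partialDeriv j (fun y => velocity V y i) x := by
    intro i j
    rw [← partialDeriv_const_mul (hV i), ← partialDeriv_add (hU i) ((hV i).const_mul ε)]
    rfl
  funext i j
  simp only [curl, h, Pi.add_apply, Pi.smul_apply, smul_eq_mul]
  ring

theorem partialDeriv_velocity_eulerRHS (hP : IsEquationOfState P) {U : Fields n} {x : Space n}
    (hU : IsRegularAt U x) (i j : Fin n) :
    partialDeriv j (fun y => velocity (eulerRHS P U) y i) x =
      -(∑ k, (velocity U x k * partialDeriv j (partialDeriv k fun y => velocity U y i) x +
        partialDeriv j (fun y => velocity U y k) x *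
          partialDeriv k (fun y => velocity U y i) x)) - partialDeriv j (force P U i) x := by
  have hv : ∀ k, DifferentiableAt ℝ (fun y => velocity U y k) x := fun k =>
    (hU.velocity k).differentiableAt (by simp)
  have hvd : ∀ k, DifferentiableAt ℝ (partialDeriv k fun y => velocity U y i) x := fun k =>
    ((hU.velocity i).partialDeriv k).differentiableAt (by simp)
  have hs : DifferentiableAt ℝ (fun y => ∑ k, velocity U y k *
      partialDeriv k (fun y => velocity U y i) y) x :=
    DifferentiableAt.fun_sum fun k _ => (hv k).mul (hvd k)
  simp_rw [velocity_eulerRHS]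
  rw [partialDeriv_sub hs.fun_neg ((hU.force hP i).differentiableAt (by simp)), partialDeriv_neg,
    partialDeriv_sum (fun k _ => (hv k).fun_mul (hvd k))]
  congr 2
  exact Finset.sum_congr rfl fun k _ => partialDeriv_mul (hv k) (hvd k) j

/-- The continuity equation of the vorticity scalar, with the baroclinic source term. -/
theorem flux_vorticityScalar (hP : IsEquationOfState P) (hn : Even n) (c : ℝ)
    {T : ℝ → Fields n → Space n → ℝ}
    (hT : ∀ t U x, IsRegularAt U x → T t U x = c * vorticityScalar U x)
    (t : ℝ) {U : Fields n} {x : Space n} (hU : IsRegularAt U x) :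
    evolDeriv P T t U x + divergence (fun y => T t U y • velocity U y) x =
      c * fderiv ℝ pfaffian (curl U x) fun i j =>
        (partialDeriv i (force P U j) x - partialDeriv j (force P U i) x) / 2 := by
  have hv : ∀ k, DifferentiableAt ℝ (fun y => velocity U y k) x := fun k =>
    (hU.velocity k).differentiableAt (by simp)
  have hR : ∀ k, DifferentiableAt ℝ (fun y => velocity (eulerRHS P U) y k) x := fun k =>
    (contDiffAt_pi.1 (contDiffAt_fst.comp x (hU.eulerRHS hP)) k).differentiableAt (by simp)
  set D := fderiv ℝ pfaffian (curl U x) with hD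
  set A : Fin n → Fin n → ℝ := fun i j => partialDeriv j (fun y => velocity U y i) x with hA
  have hevol : evolDeriv P T t U x = c * D (curl (eulerRHS P U) x) := by
    have hc : HasDerivAt (fun ε : ℝ => curl U x + ε • curl (eulerRHS P U) x)
        (curl (eulerRHS P U) x) 0 := by
      simpa using ((hasDerivAt_id (0 : ℝ)).smul_const (curl (eulerRHS P U) x)).const_add (curl U x)
    have h1 := (HasFDerivAt.comp_hasDerivAt_of_eq (0 : ℝ) (hasFDerivAt_pfaffian (curl U x)) hc
      (by simp)).const_mul c
    rw [evolDeriv, ← h1.deriv]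
    refine Filter.EventuallyEq.deriv_eq ?_
    filter_upwards [hU.add_smul_eulerRHS hP] with ε hε
    rw [hT _ _ _ hε, vorticityScalar_eq, curl_add_smul hv hR]
    rfl
  have hdiv : divergence (fun y => T t U y • velocity U y) x =
      c * (D (∑ k, velocity U x k • fun i j => partialDeriv k (fun y => curl U y i j) x) +
        (∑ i, A i i) * pfaffian (curl U x)) := by
    have hcd : HasFDerivAt (fun y => curl U y) (ContinuousLinearMap.pi fun i =>
        ContinuousLinearMap.pi fun j => fderiv ℝ (fun y => curl U y i j) x) x :=
      hasFDerivAt_pi.2 fun i => hasFDerivAt_pi.2 fun j =>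
        ((hU.curl i j).differentiableAt (by simp)).hasFDerivAt
    have hpf := (hasFDerivAt_pfaffian (curl U x)).comp x hcd
    have hterm : ∀ i, partialDeriv i (fun y => (T t U y • velocity U y) i) x =
        c * (velocity U x i * D (fun a b => partialDeriv i (fun y => curl U y a b) x) +
          A i i * pfaffian (curl U x)) := by
      intro i
      have hev : (fun y => (T t U y • velocity U y) i) =ᶠ[𝓝 x]
          fun y => c * (pfaffian (curl U y) * velocity U y i) := by
        filter_upwards [hU.eventually] with y hy
        rw [Pi.smul_apply, hT _ _ _ hy, vorticityScalar_eq, smul_eq_mul, mul_assoc]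
      have hd : DifferentiableAt ℝ (fun y => pfaffian (curl U y)) x := hpf.differentiableAt
      rw [partialDeriv_congr hev, partialDeriv_const_mul (hd.fun_mul (hv i)),
        partialDeriv_mul hd (hv i),
        show partialDeriv i (fun y => pfaffian (curl U y)) x = _ from
          HasFDerivAt.partialDeriv_eq hpf i, ContinuousLinearMap.comp_apply]
      have e : (ContinuousLinearMap.pi fun i => ContinuousLinearMap.pi fun j =>
          fderiv ℝ (fun y => curl U y i j) x) (Pi.single i 1) =
          fun a b => partialDeriv i (fun y => curl U y a b) x := rfl
      rw [e]
      ring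
    rw [divergence, Finset.sum_congr rfl fun i _ => hterm i, ← Finset.mul_sum,
      Finset.sum_add_distrib, Finset.sum_mul, map_sum]
    simp_rw [map_smul, smul_eq_mul]
  -- With the expansion term rewritten as the derivative in direction $A^T\omega+\omega A$,
  -- everything lies inside one linear map. Its argument is the vorticity equation, checked
  -- entrywise, with mixed second derivatives of $\mathbf u$ commuted.
  rw [hevol, hdiv, ← fderiv_pfaffian_congruence hn A (curl U x), ← mul_add, ← map_add, ← map_add]
  congr 2
  funext i j
  have hcurl : ∀ i j, curl U x i j = (A i j - A j i) / 2 := fun _ _ => rfl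
  simp only [Pi.add_apply, Finset.sum_apply, Pi.smul_apply, smul_eq_mul, hcurl,
    partialDeriv_curl hU]
  rw [curl, partialDeriv_velocity_eulerRHS hP hU, partialDeriv_velocity_eulerRHS hP hU]
  have hs : (∑ k, (velocity U x k * partialDeriv j (partialDeriv k fun y => velocity U y i) x +
        A k j * A i k)) -
      (∑ k, (velocity U x k * partialDeriv i (partialDeriv k fun y => velocity U y j) x +
        A k i * A j k)) =
      2 * ((∑ k, velocity U x k *
        ((partialDeriv k (partialDeriv j fun y => velocity U y i) x -
          partialDeriv k (partialDeriv i fun y => velocity U y j) x) / 2)) +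
        ∑ k, (A k i * ((A k j - A j k) / 2) + (A i k - A k i) / 2 * A k j)) := by
    rw [← Finset.sum_sub_distrib, ← Finset.sum_add_distrib, Finset.mul_sum]
    refine Finset.sum_congr rfl fun k _ => ?_
    rw [partialDeriv_comm (hU.velocity i) j k, partialDeriv_comm (hU.velocity j) i k]
    ring
  simp only [hA] at hs ⊢
  linarith

/-- The mixed second derivatives of the pressure cancel, leaving the derivative of $\rho^{-1}$: the
baroclinic term. -/
theorem force_antisymm (hP : IsEquationOfState P) {U : Fields n} {x : Space n}
    (hU : IsRegularAt U x) (i j : Fin n) :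
    partialDeriv i (force P U j) x - partialDeriv j (force P U i) x =
      (density U x)⁻¹ ^ 2 * (partialDeriv j (density U) x * partialDeriv i (pressure P U) x -
        partialDeriv i (density U) x * partialDeriv j (pressure P U) x) := by
  have hd : DifferentiableAt ℝ (density U) x := hU.density.differentiableAt (by simp)
  have hinv : HasFDerivAt (fun y => (density U y)⁻¹) _ x :=
    (hasDerivAt_inv hU.2.ne').comp_hasFDerivAt x hd.hasFDerivAt
  have hpi : ∀ i, partialDeriv i (fun y => (density U y)⁻¹) x =
      -(density U x)⁻¹ ^ 2 * partialDeriv i (density U) x := by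
    intro i
    rw [HasFDerivAt.partialDeriv_eq hinv]
    simp [partialDeriv]
  have hf : ∀ i j, partialDeriv i (force P U j) x =
      (density U x)⁻¹ * partialDeriv i (partialDeriv j (pressure P U)) x +
      (-(density U x)⁻¹ ^ 2 * partialDeriv i (density U) x) * partialDeriv j (pressure P U) x := by
    intro i j
    rw [← hpi]
    exact partialDeriv_mul hinv.differentiableAt
      (((hU.pressure hP).partialDeriv j).differentiableAt (by simp)) i
  rw [hf, hf, partialDeriv_comm (hU.pressure hP) j i]
  ring

/-- A pressure depending locally on the density alone has gradient parallel to that of the density.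
-/
theorem force_symm_of_barotropic (hP : IsEquationOfState P) {U : Fields n} {x : Space n}
    (hU : IsRegularAt U x) {s : ℝ} (hs : pressure P U =ᶠ[𝓝 x] fun y => P (density U y) s)
    (i j : Fin n) :
    partialDeriv i (force P U j) x - partialDeriv j (force P U i) x = 0 := by
  have hq : DifferentiableAt ℝ (fun r => P r s) (density U x) := by
    have h1 : ContDiffAt ℝ ∞ (fun q : ℝ × ℝ => P q.1 q.2) (density U x, s) :=
      hP.contDiffAt (isOpen_pos_fst.mem_nhds hU.2)
    exact (h1.differentiableAt (by simp)).comp (density U x)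
      (f := fun r => (r, s)) (by fun_prop)
  have hd : DifferentiableAt ℝ (density U) x := hU.density.differentiableAt (by simp)
  have hp : ∀ i, partialDeriv i (pressure P U) x =
      deriv (fun r => P r s) (density U x) * partialDeriv i (density U) x := by
    intro i
    rw [partialDeriv_congr hs]
    have h2 := hq.hasDerivAt.comp_hasFDerivAt x hd.hasFDerivAt
    rw [show partialDeriv i (fun y => P (density U y) s) x = _ from
      HasFDerivAt.partialDeriv_eq h2 i]
    rfl
  rw [force_antisymm hP hU, hp, hp]
  ring

theorem isMovingBoundaryCOM_circulation (hP : IsEquationOfState P) (hn : Even n) (h2 : 1 < n)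
    {𝒜 : Fields n → Space n → Prop} (h𝒜 : IsIsentropicFlow P 𝒜) :
    IsMovingBoundaryCOM P 𝒜 (circulation (n := n)) := by
  have hreg : ∀ U x, 𝒜 U x → IsRegularAt U x := by
    rcases h𝒜 with ⟨rfl, -⟩ | ⟨s, rfl⟩
    exacts [fun _ _ h => h, fun _ _ h => h.1]
  -- A rigid-type field with nonzero Pfaffian, admissible in both isentropic cases, witnesses that
  -- the divergence is not identically zero.
  obtain ⟨s, hs⟩ : ∃ s, ∀ x, 𝒜 (affineField 1 s 0 (blockForm hn 1)) x := by
    rcases h𝒜 with ⟨rfl, -⟩ | ⟨s, rfl⟩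
    exacts [⟨0, fun x => (isConstEntropyAt_affineField one_pos 0 _ _ x).1⟩,
      ⟨s, isConstEntropyAt_affineField one_pos s _ _⟩]
  refine ⟨isLocalVector_circulation hreg, ⟨0, _, 0, hs 0, ?_⟩, fun t U x hUx => ?_⟩
  · rw [totalDiv_circulation h2 _ (hreg _ _ (hs 0)), vorticityScalar_eq, curl_affineField,
      neg_ne_zero]
    have : (fun i j => (blockForm hn 1 i j - blockForm hn 1 j i) / 2) = blockForm hn 1 := by
      funext i j
      rw [blockForm_antisymm hn 1 i j]
      ring
    rw [this]
    exact (pfaffian_blockForm_one_pos hn).ne'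
  · have hU := hreg U x hUx
    have hbar : ∃ s, pressure P U =ᶠ[𝓝 x] fun y => P (density U y) s := by
      rcases h𝒜 with ⟨-, p, hp⟩ | ⟨s, rfl⟩
      -- The pressure ignores the entropy here, so any reference value serves.
      · refine ⟨0, ?_⟩
        filter_upwards [hU.eventually] with y hy
        rw [pressure, hp _ _ hy.2, hp _ _ hy.2]
      · refine ⟨s, ?_⟩
        filter_upwards [hUx.2] with y hy
        rw [pressure, hy]
    obtain ⟨s, hs⟩ := hbar
    rw [flux_vorticityScalar hP hn (-1) (fun t U x h => by
      rw [totalDiv_circulation h2 _ h]; ring) t hU]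
    simp_rw [force_symm_of_barotropic hP hU hs]
    have : (fun _ _ => 0 / 2 : Fin n → Fin n → ℝ) = 0 := by
      funext i j
      simp
    rw [this, map_zero, mul_zero]

/-- The fields with velocity `M x`, density `ρ + x₀` and entropy `s + x₁`. -/
def stratifiedField (h2 : 1 < n) (ρ s : ℝ) (M : Fin n → Fin n → ℝ) : Fields n := fun x =>
  (fun i => ∑ j, M i j * x j, ρ + x ⟨0, by omega⟩, s + x ⟨1, h2⟩)

/-- A multiple of the vorticity scalar is not conserved in non-isentropic flow. -/
theorem eq_zero_of_isNonisentropic (hP : IsEquationOfState P) (hS : IsNonisentropic P)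
    (hn : Even n) (h2 : 1 < n) {c : ℝ} {T : ℝ → Fields n → Space n → ℝ}
    (hT : ∀ t U x, IsRegularAt U x → T t U x = c * vorticityScalar U x)
    (hflux : HasZeroMovingFlux P IsRegularAt T) : c = 0 := by
  obtain ⟨ρ, s, hρ, hPs⟩ := hS
  -- The density gradient is along $e_0$ and the entropy gradient along $e_1$, so the baroclinic
  -- source is a multiple of $e_0\wedge e_1$, exactly the block that this curl lacks. The derivative
  -- of the Pfaffian in that direction is nonzero.
  set M := blockForm hn 0
  set U := stratifiedField h2 ρ s M with hUdef
  have hUs : ContDiff ℝ ∞ U := by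
    simp only [hUdef]
    unfold stratifiedField
    fun_prop
  have hρ0 : density U 0 = ρ := by simp [hUdef, stratifiedField, density]
  have hU : IsRegularAt U 0 := ⟨Filter.Eventually.of_forall fun _ => hUs.contDiffAt, by
    rw [hρ0]; exact hρ⟩
  have hcurl : curl U 0 = M := by
    have h : curl U 0 = curl (affineField ρ s 0 M) 0 := by
      have : ∀ i, (fun y => velocity U y i) = fun y => velocity (affineField ρ s 0 M) y i := by
        intro i
        funext y
        simp [velocity, hUdef, stratifiedField, affineField]
      funext i j
      simp only [curl, this]
    rw [h, curl_affineField]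
    funext i j
    rw [show M j i = -M i j from blockForm_antisymm hn 0 i j]
    ring
  have hdρ : ∀ i, partialDeriv i (density U) 0 = if i.1 = 0 then 1 else 0 := by
    intro i
    change partialDeriv i (fun y => ρ + y ⟨0, by omega⟩) 0 = _
    rw [partialDeriv_add (by fun_prop) (by fun_prop), partialDeriv_const, partialDeriv_coord]
    simp [Fin.ext_iff]
  have hPd : DifferentiableAt ℝ (fun q : ℝ × ℝ => P q.1 q.2) (ρ, s) :=
    (hP.contDiffAt (isOpen_pos_fst.mem_nhds hρ)).differentiableAt (by simp)
  set a := fderiv ℝ (fun q : ℝ × ℝ => P q.1 q.2) (ρ, s) (1, 0)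
  have hb : fderiv ℝ (fun q : ℝ × ℝ => P q.1 q.2) (ρ, s) (0, 1) = deriv (P ρ) s := by
    have h1 : HasDerivAt (fun r : ℝ => (ρ, r)) (0, 1) s :=
      (hasDerivAt_const s ρ).prodMk (hasDerivAt_id s)
    exact (hPd.hasFDerivAt.comp_hasDerivAt s h1).deriv.symm
  have hdp : ∀ i, partialDeriv i (pressure P U) 0 =
      a * (if i.1 = 0 then 1 else 0) + deriv (P ρ) s * if i.1 = 1 then 1 else 0 := by
    intro i
    have h1 : HasFDerivAt (fun y : Space n => (ρ + y ⟨0, by omega⟩, s + y ⟨1, h2⟩))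
        ((ContinuousLinearMap.proj ⟨0, by omega⟩ : Space n →L[ℝ] ℝ).prod
          (ContinuousLinearMap.proj ⟨1, h2⟩)) 0 :=
      ((hasFDerivAt_apply _ _).const_add ρ).prodMk ((hasFDerivAt_apply _ _).const_add s)
    have h3 : HasFDerivAt (fun q : ℝ × ℝ => P q.1 q.2)
        (fderiv ℝ (fun q : ℝ × ℝ => P q.1 q.2) (ρ, s))
        ((fun y : Space n => (ρ + y ⟨0, by omega⟩, s + y ⟨1, h2⟩)) 0) := by
      simpa using! hPd.hasFDerivAt
    have h4 := h3.comp (0 : Space n) h1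
    rw [show partialDeriv i (pressure P U) 0 = _ from HasFDerivAt.partialDeriv_eq h4 i, ← hb]
    have e : ((ContinuousLinearMap.proj ⟨0, by omega⟩ : Space n →L[ℝ] ℝ).prod
        (ContinuousLinearMap.proj ⟨1, h2⟩ : Space n →L[ℝ] ℝ)) (Pi.single i 1) =
        (if i.1 = 0 then (1 : ℝ) else 0) • ((1 : ℝ), (0 : ℝ)) +
          (if i.1 = 1 then (1 : ℝ) else 0) • ((0 : ℝ), (1 : ℝ)) := by
      have e1 : (0 = i.1) ↔ (i.1 = 0) := eq_comm
      have e2 : (1 = i.1) ↔ (i.1 = 1) := eq_comm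
      refine Prod.ext ?_ ?_ <;> simp [Pi.single_apply, Fin.ext_iff, e1, e2] <;>
        split_ifs <;> simp
    rw [ContinuousLinearMap.comp_apply, e, map_add, map_smul, map_smul, smul_eq_mul, smul_eq_mul,
      mul_comm, mul_comm (if i.1 = 1 then (1 : ℝ) else 0)]
  have h := hflux 0 U 0 hU
  rw [flux_vorticityScalar hP hn c hT 0 hU, hcurl] at h
  have e : (fun i j => (partialDeriv i (force P U j) 0 - partialDeriv j (force P U i) 0) / 2) =
      (-(ρ⁻¹ ^ 2 * deriv (P ρ) s / 2)) • (blockForm hn 1 - blockForm hn 0) := by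
    funext i j
    rw [force_antisymm hP hU, Pi.smul_apply, Pi.smul_apply, blockForm_one_sub_blockForm_zero,
      hρ0, hdρ, hdρ, hdp, hdp, smul_eq_mul]
    ring
  rw [e, map_smul, fderiv_pfaffian_blockForm hn h2, smul_eq_mul] at h
  have hne : -(ρ⁻¹ ^ 2 * deriv (P ρ) s / 2) * pfaffian (blockForm hn 1) ≠ 0 :=
    mul_ne_zero (neg_ne_zero.2 (div_ne_zero (mul_ne_zero (by positivity) hPs) two_ne_zero))
      (pfaffian_blockForm_one_pos hn).ne'
  exact (mul_eq_zero.1 h).resolve_right hne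

/-! ### Classification -/

theorem IsLocalVector.mono {𝒜 ℬ : Fields n → Space n → Prop} (h : ∀ U x, ℬ U x → 𝒜 U x)
    {Θ : ℝ → Fields n → Space n → Space n} (hΘ : IsLocalVector 𝒜 Θ) : IsLocalVector ℬ Θ := by
  obtain ⟨k, L, hL, hΘL⟩ := hΘ
  exact ⟨k, L, hL, fun t U x hU => hΘL t U x (h U x hU)⟩

theorem IsRegularAt.curl_antisymm (U : Fields n) (x : Space n) (i j : Fin n) :
    Fluid.curl U x j i = -Fluid.curl U x i j := by
  simp only [Fluid.curl]
  ring

/-- The admissible classes of fields: all regular ones, or those of a constant entropy. -/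
def IsFlowClass (𝒜 : Fields n → Space n → Prop) : Prop :=
  𝒜 = IsRegularAt ∨ ∃ s, 𝒜 = IsConstEntropyAt s

theorem IsIsentropicFlow.isFlowClass {𝒜 : Fields n → Space n → Prop}
    (h : IsIsentropicFlow P 𝒜) : IsFlowClass 𝒜 := by
  rcases h with ⟨h, -⟩ | h
  exacts [Or.inl h, Or.inr h]

theorem IsFlowClass.isRegularAt {𝒜 : Fields n → Space n → Prop} (h : IsFlowClass 𝒜)
    {U : Fields n} {x : Space n} (hU : 𝒜 U x) : IsRegularAt U x := by
  rcases h with rfl | ⟨s, rfl⟩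
  exacts [hU, hU.1]

theorem IsFlowClass.eventually {𝒜 : Fields n → Space n → Prop} (h : IsFlowClass 𝒜)
    {U : Fields n} {x : Space n} (hU : 𝒜 U x) : ∀ᶠ y in 𝓝 x, 𝒜 U y := by
  rcases h with rfl | ⟨s, rfl⟩
  · exact hU.eventually
  · filter_upwards [hU.1.eventually, hU.2.eventually_nhds] with y h1 h2 using ⟨h1, h2⟩

/-- In odd dimensions a density of vorticity form of a constant of motion vanishes. -/
theorem totalDiv_eq_zero_of_odd (hn : Odd n) {𝒜 : Fields n → Space n → Prop}
    (h𝒜 : IsFlowClass 𝒜) {Θ : ℝ → Fields n → Space n → Space n} (hΘ : IsLocalVector 𝒜 Θ)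
    (hflux : HasZeroMovingFlux P 𝒜 (totalDiv Θ)) (hv : HasVorticityForm 𝒜 (totalDiv Θ))
    (t : ℝ) {U : Fields n} {x : Space n} (hU : 𝒜 U x) : totalDiv Θ t U x = 0 := by
  obtain ⟨F, hF, hTF⟩ : ∃ F : ℝ × ℝ × Space n × Space n → ℝ, ContDiffOn ℝ ∞ F {q | 0 < q.1} ∧
      ∀ t U x, 𝒜 U x → totalDiv Θ t U x =
        F (density U x, entropy U x, velocity U x, vorticityVector U x) := by
    rcases hv with ⟨he, -⟩ | ⟨-, h⟩
    exacts [absurd hn (Nat.not_odd_iff_even.2 he), h]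
  rw [hTF t U x hU]
  -- It suffices to work with fields whose entropy is constant and equal to its value at the given
  -- point; they are admissible in either class.
  have hsub : ∀ V y, IsConstEntropyAt (entropy U x) V y → 𝒜 V y := by
    rcases h𝒜 with rfl | ⟨s, rfl⟩
    · exact fun V y h => h.1
    · rw [hU.2.self_of_nhds]
      exact fun V y h => h
  exact eq_zero_of_odd hn (hΘ.mono hsub) (fun t V y h => hflux t V y (hsub V y h)) hF
    (fun t V y h => hTF t V y (hsub V y h)) (h𝒜.isRegularAt hU).2 _
    (IsRegularAt.curl_antisymm U x)

/-- In even dimensions a density of vorticity form of a constant of motion is a constant multiple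
of the vorticity scalar. -/
theorem exists_totalDiv_eq_const_mul (hn : Even n) (h2 : 1 < n)
    {𝒜 : Fields n → Space n → Prop}
    (h𝒜 : IsFlowClass 𝒜) {Θ : ℝ → Fields n → Space n → Space n} (hΘ : IsLocalVector 𝒜 Θ)
    (hflux : HasZeroMovingFlux P 𝒜 (totalDiv Θ)) (hv : HasVorticityForm 𝒜 (totalDiv Θ)) :
    ∃ c : ℝ, ∀ t U x, 𝒜 U x → totalDiv Θ t U x = c * vorticityScalar U x := by
  obtain ⟨F, hF, hTF⟩ : ∃ F : ℝ × ℝ × Space n × ℝ → ℝ, ContDiffOn ℝ ∞ F {q | 0 < q.1} ∧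
      ∀ t U x, 𝒜 U x → totalDiv Θ t U x =
        F (density U x, entropy U x, velocity U x, vorticityScalar U x) := by
    rcases hv with ⟨-, h⟩ | ⟨ho, -⟩
    exacts [h, absurd ho (Nat.not_odd_iff_even.2 hn)]
  have hlin : ∀ s, (∀ V y, IsConstEntropyAt s V y → 𝒜 V y) → ∀ {ρ : ℝ}, 0 < ρ → ∀ u w,
      F (ρ, s, u, w) = F (1, s, 0, 1) * w := fun s hsub ρ hρ u w =>
    exists_eq_const_mul_vorticityScalar hn h2 (hΘ.mono hsub)
      (fun t V y h => hflux t V y (hsub V y h)) hF (fun t V y h => hTF t V y (hsub V y h)) hρ u w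
  rcases h𝒜 with rfl | ⟨s, rfl⟩
  -- The constant-entropy analysis leaves a coefficient depending on $s$. When the entropy is free
  -- it can be varied too, and the vanishing first variation removes this dependence.
  · have hconst : ∀ s, F (1, s, 0, 1) = F (1, 0, 0, 1) := by
      have hd : ∀ s : ℝ, HasDerivAt (fun s => F (1, s, 0, 1)) 0 s := by
        intro s
        obtain ⟨M, hM, hM1⟩ := exists_pfaffian_eq hn h2 1
        have h0 := fderiv_eq_zero_of_variation (fun _ _ h => h) hΘ contDiff_pfaffian hF hTF
          one_pos s 0 hM 0 1 fun φ hφ hpos x =>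
            isRegularAt_affineField_add s 0 M (0, 0, 1) hφ hpos x
        rw [hM1] at h0
        have hc : HasDerivAt (fun s : ℝ => (((1 : ℝ), s, (0 : Space n), (1 : ℝ)) :
            ℝ × ℝ × Space n × ℝ)) (0, 1, 0, 0) s :=
          (hasDerivAt_const _ _).prodMk ((hasDerivAt_id _).prodMk
            ((hasDerivAt_const _ _).prodMk (hasDerivAt_const _ _)))
        exact ((hasFDerivAt_of_contDiffOn_pos hF (p := (1, s, 0, 1)) one_pos).comp_hasDerivAt s
          hc).congr_deriv h0
      exact fun s => is_const_of_deriv_eq_zero (fun s => (hd s).differentiableAt)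
        (fun s => (hd s).deriv) s 0
    refine ⟨F (1, 0, 0, 1), fun t U x hU => ?_⟩
    rw [hTF t U x hU, hlin _ (fun _ _ h => h.1) hU.2, hconst]
  · refine ⟨F (1, s, 0, 1), fun t U x hU => ?_⟩
    rw [hTF t U x hU, hU.2.self_of_nhds, hlin s (fun _ _ h => h) hU.1.2]

theorem hasVorticityForm_circulation (hn : Even n) (h2 : 1 < n)
    {𝒜 : Fields n → Space n → Prop} (h𝒜 : IsFlowClass 𝒜) :
    HasVorticityForm 𝒜 (totalDiv circulation) :=
  Or.inl ⟨hn, fun q => -q.2.2.2, by fun_prop, fun t _ _ hU =>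
    totalDiv_circulation h2 t (h𝒜.isRegularAt hU)⟩

theorem totalDiv_sub_smul {𝒜 : Fields n → Space n → Prop} (h𝒜 : IsFlowClass 𝒜)
    {Θ Ψ : ℝ → Fields n → Space n → Space n} (hΘ : IsLocalVector 𝒜 Θ) (hΨ : IsLocalVector 𝒜 Ψ)
    (c t : ℝ) {U : Fields n} {x : Space n} (hU : 𝒜 U x) :
    totalDiv (fun t U x => Θ t U x - c • Ψ t U x) t U x =
      totalDiv Θ t U x - c * totalDiv Ψ t U x := by
  have hd : ∀ {Θ : ℝ → Fields n → Space n → Space n}, IsLocalVector 𝒜 Θ →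
      ∀ i, DifferentiableAt ℝ (fun y => Θ t U y i) x := fun h i =>
    (contDiffAt_pi.1 (contDiffAt_localVector h (h𝒜.isRegularAt hU) (h𝒜.eventually hU) t)
      i).differentiableAt (by simp)
  simp only [totalDiv, divergence, Finset.mul_sum, ← Finset.sum_sub_distrib]
  refine Finset.sum_congr rfl fun i _ => ?_
  rw [← partialDeriv_const_mul (hd hΨ i), ← partialDeriv_sub (hd hΘ i) ((hd hΨ i).const_mul c)]
  rfl

end Fluid

end

theorem proposition3 (n : ℕ) (hn : 1 < n) (P : ℝ → ℝ → ℝ) (hP : Fluid.IsEquationOfState P) :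
    (Fluid.IsNonisentropic P →
      ¬ ∃ Θ : ℝ → Fluid.Fields n → Fluid.Space n → Fluid.Space n,
        Fluid.IsMovingBoundaryCOM P Fluid.IsRegularAt Θ ∧
          Fluid.HasVorticityForm Fluid.IsRegularAt (Fluid.totalDiv Θ)) ∧
    (∀ 𝒜 : Fluid.Fields n → Fluid.Space n → Prop, Fluid.IsIsentropicFlow P 𝒜 →
      (Even n →
        (Fluid.IsMovingBoundaryCOM P 𝒜 Fluid.circulation ∧
          Fluid.HasVorticityForm 𝒜 (Fluid.totalDiv Fluid.circulation)) ∧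
        ∀ Θ : ℝ → Fluid.Fields n → Fluid.Space n → Fluid.Space n,
          Fluid.IsMovingBoundaryCOM P 𝒜 Θ → Fluid.HasVorticityForm 𝒜 (Fluid.totalDiv Θ) →
            ∃ c : ℝ, c ≠ 0 ∧ ∀ t U x, 𝒜 U x →
              Fluid.totalDiv (fun t U x => Θ t U x - c • Fluid.circulation t U x) t U x = 0) ∧
      (Odd n →
        ¬ ∃ Θ : ℝ → Fluid.Fields n → Fluid.Space n → Fluid.Space n,
          Fluid.IsMovingBoundaryCOM P 𝒜 Θ ∧
            Fluid.HasVorticityForm 𝒜 (Fluid.totalDiv Θ))) := by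
  refine ⟨?_, fun 𝒜 h𝒜 => ⟨fun he => ⟨⟨?_, ?_⟩, ?_⟩, ?_⟩⟩
  · rintro hS ⟨Θ, ⟨hΘ, ⟨t, U, x, hU, hne⟩, hflux⟩, hv⟩
    rcases Nat.even_or_odd n with he | ho
    · obtain ⟨c, hc⟩ := Fluid.exists_totalDiv_eq_const_mul he hn (Or.inl rfl) hΘ hflux hv
      rw [hc t U x hU, Fluid.eq_zero_of_isNonisentropic hP hS he hn hc hflux, zero_mul] at hne
      exact hne rfl
    · exact hne (Fluid.totalDiv_eq_zero_of_odd ho (Or.inl rfl) hΘ hflux hv t hU)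
  · exact Fluid.isMovingBoundaryCOM_circulation hP he hn h𝒜
  · exact Fluid.hasVorticityForm_circulation he hn h𝒜.isFlowClass
  · rintro Θ ⟨hΘ, ⟨t, U, x, hU, hne⟩, hflux⟩ hv
    obtain ⟨c, hc⟩ := Fluid.exists_totalDiv_eq_const_mul he hn h𝒜.isFlowClass hΘ hflux hv
    -- The sign compensates the divergence $-\varpi$ of the circulation vector; $c=0$ would make
    -- $\Theta$ divergence-free.
    refine ⟨-c, fun h0 => hne ?_, fun t U x hU => ?_⟩
    · rw [hc t U x hU, neg_eq_zero.1 h0, zero_mul]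
    · rw [Fluid.totalDiv_sub_smul h𝒜.isFlowClass hΘ
        (Fluid.isMovingBoundaryCOM_circulation hP he hn h𝒜).1 (-c) t hU, hc t U x hU,
        Fluid.totalDiv_circulation hn t (h𝒜.isFlowClass.isRegularAt hU)]
      ring
  · rintro ho ⟨Θ, ⟨hΘ, ⟨t, U, x, hU, hne⟩, hflux⟩, hv⟩
    exact hne (Fluid.totalDiv_eq_zero_of_odd ho h𝒜.isFlowClass hΘ hflux hv t hU)
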